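/- **Theorem 1 (Minimax lower bound on estimating the moment under covariate shift).** Let $d\ge 1$, $s\ge 0$ and $q$ be integers and let $p$ be a real number with $p\ge 2$ and $q\le p\le 2q$. Let $\Omega=[0,1]^d$, and let $\mathcal W^{s,p}(\Omega)$ be the space of all $f\in L^p(\Omega)$ whose weak derivatives $D^\alpha f$, $|\alpha|\le s$, lie in $L^p(\Omega)$, with norm $\|f\|_{\mathcal W^{s,p}}=\big(\sum_{|\alpha|\le s}\|D^\alpha f\|_{L^p(\Omega)}^p\big)^{1/p}$. For $0<\underline b\le\bar b$ and $B\ge 1$ let $\mathcal V=\mathcal V(\underline b,\bar b,B,s,p)$ be the set of all triples $(f,p^\circ,p^*)$ such that $f\in\mathcal W^{s,p}(\Omega)$ and $p^\circ,p^*$ are probability densities on $\Omega$ with $\underline b\le p^\circ\le\bar b$ and $\sup_{x\in\Omega}p^*(x)/p^\circ(x)\le B$. For a density $p^*$ put $\mathcal V_{p^*}=\{(f,p^\circ):(f,p^\circ,p^*)\in\mathcal V\}$ and, for $L>0$, $\mathcal V_{p^*}(L)=\{(f,p^\circ)\in\mathcal V_{p^*}:\|f\|_{\mathcal W^{s,p}}\le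 L\}$. Let $I_f^q=\int_\Omega f(x)^q\,p^*(x)\,dx$ be the $q$-th moment of $f$ under the target. An estimator is a measurable map $\hat H:\Omega^n\times\mathbb R^n\to\mathbb R$; it is applied to the sample $\mathcal S=\{(x_i,y_i)\}_{i=1}^n$, where $x_1,\dots,x_n$ are i.i.d. with density $p^\circ$ and $y_i=f(x_i)$. (a) There is a constant $c>0$ that depends only on $d,s,p,q$ such that for all $0<\underline b\le\bar b$ and $B\ge1$, every target density $p^*$ with $\mathcal V_{p^*}\ne\emptyset$ and every $n\ge 1$, $$\inf_{\hat H}\ \sup_{(f,p^\circ)\in\mathcal V_{p^*}}\mathbb E_{\mathcal S}\big|\hat H(\mathcal S)-I_f^q\big|\ \ge\ c\,B\,\bar b\,n^{\max\{-q(\frac sd-\frac1p)-1,\,-\frac12-\frac sd\}} .$$ (b) The same rate holds on every Sobolev ball: for all $0<\underline b\le\bar b$, $B\ge 1$ and $L>0$ there is a constant $c>0$, depending only on $d,s,p,q,\underline b,\bar b,B,L$, such that for every target density $p^*$ with $\mathcal V_{p^*}\ne\emptyset$ and every $n\ge1$, $$\inf_{\hat H}\ \sup_{(f,p^\circ)\in\mathcal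 V_{p^*}(L)}\mathbb E_{\mathcal S}\big|\hat H(\mathcal S)-I_f^q\big|\ \ge\ c\,B\,\bar b\,n^{\max\{-q(\frac sd-\frac1p)-1,\,-\frac12-\frac sd\}} .$$ -/

import Mathlib

open MeasureTheory
open scoped ENNReal ContDiff

noncomputable section

namespace CovShift

/-- The unit cube `Ω = [0,1]^d`. -/
def cube (d : ℕ) : Set (Fin d → ℝ) := Set.Icc 0 1

/-- Lebesgue measure on the unit cube. -/
def cubeVolume (d : ℕ) : Measure (Fin d → ℝ) := volume.restrict (cube d)

/-- The classical partial derivative `∂φ/∂x_i`. -/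
def partialDeriv {d : ℕ} (i : Fin d) (φ : (Fin d → ℝ) → ℝ) : (Fin d → ℝ) → ℝ :=
  fun x => fderiv ℝ φ x (Pi.single i 1)

/-- The classical derivative `D^α φ = ∂_1^{α_1} ⋯ ∂_d^{α_d} φ` for a multi-index `α`. -/
def multiDeriv {d : ℕ} (α : Fin d → ℕ) (φ : (Fin d → ℝ) → ℝ) : (Fin d → ℝ) → ℝ :=
  (List.finRange d).foldr (fun i g => (partialDeriv i)^[α i] g) φ

/-- `g` is the weak derivative `D^α f` on (the interior of) the unit cube, tested against
smooth functions whose compact support lies in the open cube. It is only used for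
`f, g ∈ L^p`, so that both integrals exist. -/
def HasWeakDeriv {d : ℕ} (α : Fin d → ℕ) (f g : (Fin d → ℝ) → ℝ) : Prop :=
  ∀ φ : (Fin d → ℝ) → ℝ, ContDiff ℝ ∞ φ → HasCompactSupport φ →
    tsupport φ ⊆ interior (cube d) →
      ∫ x, f x * multiDeriv α φ x ∂(cubeVolume d)
        = (-1 : ℝ) ^ (∑ i, α i) * ∫ x, g x * φ x ∂(cubeVolume d)

/-- The multi-indices `α` with `|α| ≤ s`. -/
def multiIndices (d s : ℕ) : Finset (Fin d → ℕ) :=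
  (Fintype.piFinset fun _ => Finset.range (s + 1)).filter fun α => ∑ i, α i ≤ s

/-- `f ∈ W^{s,p}(Ω)`: `f` and all its weak derivatives of order at most `s` lie in `L^p(Ω)`. -/
def MemSobolev (d s : ℕ) (p : ℝ) (f : (Fin d → ℝ) → ℝ) : Prop :=
  MemLp f (ENNReal.ofReal p) (cubeVolume d) ∧
    ∀ α ∈ multiIndices d s, ∃ g : (Fin d → ℝ) → ℝ,
      MemLp g (ENNReal.ofReal p) (cubeVolume d) ∧ HasWeakDeriv α f g

/-- `‖D^α f‖_{L^p(Ω)}`. The weak derivative is unique up to null sets, so the infimum is over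
a single value (and it is `∞` if there is no weak derivative in `L^p`). -/
def weakDerivNorm {d : ℕ} (p : ℝ) (α : Fin d → ℕ) (f : (Fin d → ℝ) → ℝ) : ℝ≥0∞ :=
  ⨅ (g : (Fin d → ℝ) → ℝ) (_ : MemLp g (ENNReal.ofReal p) (cubeVolume d))
    (_ : HasWeakDeriv α f g), eLpNorm g (ENNReal.ofReal p) (cubeVolume d)

/-- The Sobolev norm `(∑_{|α| ≤ s} ‖D^α f‖_{L^p(Ω)}^p)^{1/p}`. -/
def sobolevNorm (d s : ℕ) (p : ℝ) (f : (Fin d → ℝ) → ℝ) : ℝ≥0∞ :=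
  (∑ α ∈ multiIndices d s, weakDerivNorm p α f ^ p) ^ (1 / p)

/-- `ρ` is a probability density function on the unit cube. Its values outside the cube play
no role. -/
structure IsDensity (d : ℕ) (ρ : (Fin d → ℝ) → ℝ) : Prop where
  measurable : Measurable ρ
  nonneg : ∀ x ∈ cube d, 0 ≤ ρ x
  lintegral_eq_one : ∫⁻ x, ENNReal.ofReal (ρ x) ∂(cubeVolume d) = 1

/-- The distribution on the unit cube with density `ρ`. -/
def densityMeasure (d : ℕ) (ρ : (Fin d → ℝ) → ℝ) : Measure (Fin d → ℝ) :=
  (cubeVolume d).withDensity fun x => ENNReal.ofReal (ρ x)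

/-- The class `𝒱` of triples `(f, p°, p*)`: `f ∈ W^{s,p}(Ω)`, the densities `p°` (source) and
`p*` (target) satisfy `bl ≤ p° ≤ bu` and `p* / p° ≤ B` on the cube. -/
def shiftClass (d s : ℕ) (p bl bu B : ℝ) :
    Set (((Fin d → ℝ) → ℝ) × ((Fin d → ℝ) → ℝ) × ((Fin d → ℝ) → ℝ)) :=
  {v | MemSobolev d s p v.1 ∧ IsDensity d v.2.1 ∧ IsDensity d v.2.2 ∧
    (∀ x ∈ cube d, bl ≤ v.2.1 x ∧ v.2.1 x ≤ bu) ∧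
    ∀ x ∈ cube d, v.2.2 x / v.2.1 x ≤ B}

/-- The section `𝒱_{p*}` of the class `𝒱` at a target density `pt`: the pairs `(f, p°)` with
`(f, p°, pt) ∈ 𝒱`. -/
def shiftClassAt (d s : ℕ) (p bl bu B : ℝ) (pt : (Fin d → ℝ) → ℝ) :
    Set (((Fin d → ℝ) → ℝ) × ((Fin d → ℝ) → ℝ)) :=
  {v | (v.1, v.2, pt) ∈ shiftClass d s p bl bu B}

/-- The pairs `(f, p°)` in `𝒱_{p*}` with `‖f‖_{W^{s,p}(Ω)} ≤ L`. -/
def shiftClassBallAt (d s : ℕ) (p bl bu B L : ℝ) (pt : (Fin d → ℝ) → ℝ) :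
    Set (((Fin d → ℝ) → ℝ) × ((Fin d → ℝ) → ℝ)) :=
  {v | v ∈ shiftClassAt d s p bl bu B pt ∧ sobolevNorm d s p v.1 ≤ ENNReal.ofReal L}

/-- The target moment `I_f^q = E_{X ∼ P*} [f(X)^q]`. -/
def moment (d q : ℕ) (pt f : (Fin d → ℝ) → ℝ) : ℝ :=
  ∫ x, f x ^ q ∂(densityMeasure d pt)

/-- The expected absolute error of the estimator `H`, for `n` i.i.d. design points `x_i` with
density `ps` and noiseless observations `y_i = f(x_i)`. -/
def risk (d q n : ℕ) (pt : (Fin d → ℝ) → ℝ)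
    (H : (Fin n → Fin d → ℝ) × (Fin n → ℝ) → ℝ) (f ps : (Fin d → ℝ) → ℝ) : ℝ≥0∞ :=
  ∫⁻ x, ENNReal.ofReal |H (x, fun i => f (x i)) - moment d q pt f|
    ∂(Measure.pi fun _ : Fin n => densityMeasure d ps)

/-- The minimax risk over a class `C` of pairs `(f, p°)`, the infimum being over all
(measurable) estimators. -/
def minimaxRisk (d q n : ℕ) (pt : (Fin d → ℝ) → ℝ)
    (C : Set (((Fin d → ℝ) → ℝ) × ((Fin d → ℝ) → ℝ))) : ℝ≥0∞ :=
  ⨅ (H : (Fin n → Fin d → ℝ) × (Fin n → ℝ) → ℝ) (_ : Measurable H),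
    ⨆ v ∈ C, risk d q n pt H v.1 v.2

/-- The exponent `max {-q (s/d - 1/p) - 1, -1/2 - s/d}`. -/
def rateExponent (d s q : ℕ) (p : ℝ) : ℝ :=
  max (-(q : ℝ) * ((s : ℝ) / d - 1 / p) - 1) (-(1 / 2) - (s : ℝ) / d)

end CovShift

end

/-! Divide the cube into `m ^ d ≍ n` cells of side `1 / m` and place smooth bumps in a subset of `j`
of them, on top of a constant. A given cell is missed by the whole sample with probability at least
`1 / 2`, and then the data do not reveal whether that cell carries a bump. Conditionally on the
data, the moment therefore fluctuates like a Rademacher sum over the missed cells, and by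
Khintchine's inequality every estimator errs by the order of the `ℓ²` norm of the bump moments,
which is at least their sum divided by `√j`. Since `p* ≤ B * bu`, bumps with a wide enough plateau
capture half of the target mass, and the `j` heaviest cells carry their share `j / m ^ d` of it.
Within a fixed Sobolev ball, a single high bump (`j = 1`) gives the exponent `-q (s/d - 1/p) - 1`,
and low bumps in all cells (`j = m ^ d`) give `-1/2 - s/d`.

The bound grows like `L ^ q` with the radius `L` of the Sobolev ball, so the minimax risk over the
whole space is infinite. -/

namespace CovShift

section FiniteSums

variable {ι : Type*}

theorem map_sum_of_subsingleton_support {M N : Type*} [AddCommMonoid M] [AddCommMonoid N]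
    {F : M → N} (hF : F 0 = 0) {u : ι → M} (hu : (Function.support u).Subsingleton)
    (T : Finset ι) : F (∑ k ∈ T, u k) = ∑ k ∈ T, F (u k) := by
  by_cases h : ∃ k ∈ T, u k ≠ 0
  · obtain ⟨k, hkT, hk⟩ := h
    have hne : ∀ j ∈ T, j ≠ k → u j = 0 := fun j _ hj => by_contra fun huj => hj (hu huj hk)
    rw [Finset.sum_eq_single_of_mem k hkT hne,
      Finset.sum_eq_single_of_mem k hkT fun j hj hjk => by rw [hne j hj hjk, hF]]
  · push Not at h
    rw [Finset.sum_eq_zero h, hF, Finset.sum_eq_zero fun k hk => by rw [h k hk, hF]]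

theorem exists_subset_card_eq_and_mul_sum_le (w : ι → ℝ) {j : ℕ} (S : Finset ι)
    (hj : j ≤ S.card) :
    ∃ T ⊆ S, T.card = j ∧ j * ∑ k ∈ S, w k ≤ S.card * ∑ k ∈ T, w k := by
  classical
  induction hm : S.card - j generalizing S with
  | zero => exact ⟨S, subset_rfl, by lia, by rw [show j = S.card by lia]⟩
  | succ r ih =>
    have hS : S.Nonempty := Finset.card_pos.1 (by lia)
    obtain ⟨k, hk, hmin⟩ := S.exists_min_image w hS
    have hcard : ((S.erase k).card : ℝ) = S.card - 1 := by
      rw [Finset.cast_card_erase_of_mem hk]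
    have hadd : ∑ i ∈ S.erase k, w i + w k = ∑ i ∈ S, w i := Finset.sum_erase_add S w hk
    have hwk : S.card * w k ≤ ∑ i ∈ S, w i := by
      simpa using Finset.card_nsmul_le_sum S w (w k) hmin
    obtain ⟨T, hTS, hT, hle⟩ := ih (S.erase k) (by grind) (by grind)
    refine ⟨T, hTS.trans (S.erase_subset k), hT, ?_⟩
    rcases Nat.eq_zero_or_pos (S.erase k).card with h0 | hpos
    · have hj0 : j = 0 := by grind
      rw [Finset.card_eq_zero.1 (hT.trans hj0), hj0]
      simp
    · refine le_of_mul_le_mul_left ?_ (Nat.cast_pos (α := ℝ).2 hpos)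
      calc ((S.erase k).card : ℝ) * (j * ∑ i ∈ S, w i)
          = j * ((S.card - 1) * ∑ i ∈ S, w i) := by rw [hcard]; ring
        _ ≤ j * (S.card * ∑ i ∈ S.erase k, w i) := by
            gcongr j * ?_
            linear_combination hwk - (S.card : ℝ) * hadd
        _ = S.card * (j * ∑ i ∈ S.erase k, w i) := by ring
        _ ≤ S.card * ((S.erase k).card * ∑ i ∈ T, w i) := by gcongr
        _ = (S.erase k).card * (S.card * ∑ i ∈ T, w i) := by ring

theorem sum_div_sqrt_card_le_sqrt_sum_sq (S : Finset ι) (w : ι → ℝ) :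
    (∑ k ∈ S, w k) / √S.card ≤ √(∑ k ∈ S, w k ^ 2) := by
  refine div_le_of_le_mul₀ (Real.sqrt_nonneg _) (Real.sqrt_nonneg _) ?_
  rw [mul_comm, ← Real.sqrt_mul (Nat.cast_nonneg _)]
  exact Real.le_sqrt_of_sq_le sq_sum_le_card_mul_sum_sq

end FiniteSums

section Rademacher

variable {ι : Type*} [DecidableEq ι]

/-- The value of the Rademacher sum `∑ k ∈ S, ε k * w k` at the sign pattern `ε` that is `1` on
`T ⊆ S` and `-1` on `S \ T`; averages over `ε` are averages over `T ∈ S.powerset`. -/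
def rademacherSum (S : Finset ι) (w : ι → ℝ) (T : Finset ι) : ℝ :=
  ∑ k ∈ T, w k - ∑ k ∈ S \ T, w k

theorem sum_powerset_insert_rademacherSum (F : ℝ → ℝ) {S : Finset ι} {a : ι} (ha : a ∉ S)
    (w : ι → ℝ) :
    ∑ T ∈ (insert a S).powerset, F (rademacherSum (insert a S) w T) =
      ∑ T ∈ S.powerset, (F (rademacherSum S w T - w a) + F (rademacherSum S w T + w a)) := by
  rw [Finset.sum_powerset_insert ha, ← Finset.sum_add_distrib]
  refine Finset.sum_congr rfl fun T hT => ?_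
  have haT : a ∉ T := fun h => ha (Finset.mem_powerset.1 hT h)
  have haST : a ∉ S \ T := fun h => ha (Finset.mem_sdiff.1 h).1
  rw [rademacherSum, rademacherSum, rademacherSum, Finset.insert_sdiff_of_notMem S haT,
    Finset.insert_sdiff_insert, Finset.sdiff_insert_of_notMem ha, Finset.sum_insert haT,
    Finset.sum_insert haST]
  ring_nf

theorem sum_powerset_rademacherSum_sq (S : Finset ι) (w : ι → ℝ) :
    ∑ T ∈ S.powerset, rademacherSum S w T ^ 2 = 2 ^ S.card * ∑ k ∈ S, w k ^ 2 := by
  induction S using Finset.induction_on with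
  | empty => simp [rademacherSum]
  | insert a S ha ih =>
    have hpar : ∀ x : ℝ, (x - w a) ^ 2 + (x + w a) ^ 2 = 2 * x ^ 2 + 2 * w a ^ 2 :=
      fun x => by ring
    rw [sum_powerset_insert_rademacherSum (· ^ 2) ha, Finset.card_insert_of_notMem ha,
      Finset.sum_insert ha]
    simp only [hpar, Finset.sum_add_distrib, ← Finset.mul_sum, ih, Finset.sum_const,
      Finset.card_powerset, nsmul_eq_mul, Nat.cast_pow, Nat.cast_ofNat]
    ring

theorem sum_powerset_rademacherSum_pow_four_le (S : Finset ι) (w : ι → ℝ) :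
    ∑ T ∈ S.powerset, rademacherSum S w T ^ 4 ≤ 3 * 2 ^ S.card * (∑ k ∈ S, w k ^ 2) ^ 2 := by
  induction S using Finset.induction_on with
  | empty => simp [rademacherSum]
  | insert a S ha ih =>
    have hbinom : ∀ x : ℝ, (x - w a) ^ 4 + (x + w a) ^ 4
      = 2 * x ^ 4 + 12 * w a ^ 2 * x ^ 2 + 2 * w a ^ 4 := fun x => by ring
    have hwa : (0 : ℝ) ≤ 2 ^ S.card * w a ^ 4 := by positivity
    rw [sum_powerset_insert_rademacherSum (· ^ 4) ha, Finset.card_insert_of_notMem ha,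
      Finset.sum_insert ha, pow_succ 2 S.card]
    simp only [hbinom, Finset.sum_add_distrib, ← Finset.mul_sum, sum_powerset_rademacherSum_sq,
      Finset.sum_const, Finset.card_powerset, nsmul_eq_mul, Nat.cast_pow, Nat.cast_ofNat]
    linear_combination 2 * ih + 4 * hwa

/-- The quartic is tangent to `|x|` at `2 * r`; it reduces Khintchine's inequality to the second and
fourth moments of the Rademacher sum. -/
theorem sq_sub_pow_four_le_abs {r : ℝ} (hr : 0 < r) (x : ℝ) :
    3 / (4 * r) * x ^ 2 - 1 / (16 * r ^ 3) * x ^ 4 ≤ |x| := by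
  have hdiff : |x| - (3 / (4 * r) * |x| ^ 2 - 1 / (16 * r ^ 3) * |x| ^ 4)
      = |x| * (|x| - 2 * r) ^ 2 * (|x| + 4 * r) / (16 * r ^ 3) := by
    field_simp
    ring
  rw [← sq_abs, ← Even.pow_abs (by decide : Even 4), ← sub_nonneg, hdiff]
  positivity

theorem sqrt_sum_sq_le_sum_powerset_abs_rademacherSum (S : Finset ι) (w : ι → ℝ) :
    2 ^ S.card * (√(∑ k ∈ S, w k ^ 2) / 2) ≤ ∑ T ∈ S.powerset, |rademacherSum S w T| := by
  have hV := Real.sq_sqrt (Finset.sum_nonneg fun k (_ : k ∈ S) => sq_nonneg (w k))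
  have h₂ := sum_powerset_rademacherSum_sq S w
  have h₄ := sum_powerset_rademacherSum_pow_four_le S w
  rw [← hV] at h₂ h₄
  rcases (Real.sqrt_nonneg (∑ k ∈ S, w k ^ 2)).eq_or_lt with h0 | hr
  · rw [← h0, zero_div, mul_zero]
    positivity
  set r := √(∑ k ∈ S, w k ^ 2)
  calc 2 ^ S.card * (r / 2)
      ≤ 2 ^ S.card * (9 / 16 * r) := by gcongr ?_ * ?_; linarith
    _ = 3 / (4 * r) * (2 ^ S.card * r ^ 2)
          - 1 / (16 * r ^ 3) * (3 * 2 ^ S.card * (r ^ 2) ^ 2) := by field_simp; ring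
    _ ≤ 3 / (4 * r) * ∑ T ∈ S.powerset, rademacherSum S w T ^ 2
          - 1 / (16 * r ^ 3) * ∑ T ∈ S.powerset, rademacherSum S w T ^ 4 := by
        rw [h₂]
        gcongr
    _ = ∑ T ∈ S.powerset, (3 / (4 * r) * rademacherSum S w T ^ 2
          - 1 / (16 * r ^ 3) * rademacherSum S w T ^ 4) := by
        rw [Finset.sum_sub_distrib, Finset.mul_sum, Finset.mul_sum]
    _ ≤ ∑ T ∈ S.powerset, |rademacherSum S w T| :=
        Finset.sum_le_sum fun T _ => sq_sub_pow_four_le_abs hr _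

theorem sum_sub_sum_symmDiff {S T U : Finset ι} (hU : U ⊆ S) (w : ι → ℝ) :
    ∑ k ∈ T, w k - ∑ k ∈ symmDiff T U, w k =
      rademacherSum S (fun k => if k ∈ U then w k else 0) T := by
  have hdisj : Disjoint (T \ U) (U \ T) := disjoint_sdiff_sdiff
  have hcompl : (S \ T) ∩ U = U \ T := by grind
  rw [rademacherSum, ← Finset.sum_inter_add_sum_sdiff T U, Finset.sum_ite_mem,
    Finset.sum_ite_mem, hcompl, symmDiff, Finset.sup_eq_union, Finset.sum_union hdisj]
  ring

theorem sum_div_sqrt_card_le_sum_powerset_abs_sub {S U : Finset ι} (hU : U ⊆ S) (w : ι → ℝ)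
    {h : Finset ι → ℝ} (hflip : ∀ T, h (symmDiff T U) = h T) :
    2 ^ S.card * ((∑ k ∈ U, w k) / (4 * √S.card)) ≤
      ∑ T ∈ S.powerset, |h T - ∑ k ∈ T, w k| := by
  set v : ι → ℝ := fun k => if k ∈ U then w k else 0
  have hv : ∑ k ∈ S, v k = ∑ k ∈ U, w k := by
    rw [Finset.sum_ite_mem, Finset.inter_eq_right.2 hU]
  have hmem : ∀ T ∈ S.powerset, symmDiff T U ∈ S.powerset := fun T hT =>
    Finset.mem_powerset.2 (symmDiff_le_sup.trans (sup_le (Finset.mem_powerset.1 hT) hU))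
  have hreindex : ∑ T ∈ S.powerset, |h T - ∑ k ∈ symmDiff T U, w k|
      = ∑ T ∈ S.powerset, |h T - ∑ k ∈ T, w k| := by
    refine Finset.sum_nbij' (symmDiff · U) (symmDiff · U) hmem hmem ?_ ?_ ?_
    · exact fun T _ => symmDiff_symmDiff_cancel_right U T
    · exact fun T _ => symmDiff_symmDiff_cancel_right U T
    · intro T _
      rw [hflip]
  have htri : ∀ T, |rademacherSum S v T| ≤
      |h T - ∑ k ∈ T, w k| + |h T - ∑ k ∈ symmDiff T U, w k| := fun T => by
    rw [← sum_sub_sum_symmDiff hU, abs_sub_comm (h T)]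
    exact abs_sub_le _ _ _
  have hkhintchine := calc
    2 ^ S.card * ((∑ k ∈ U, w k) / √S.card / 2)
        ≤ 2 ^ S.card * (√(∑ k ∈ S, v k ^ 2) / 2) := by
          rw [← hv]
          gcongr
          exact sum_div_sqrt_card_le_sqrt_sum_sq S v
      _ ≤ ∑ T ∈ S.powerset, |rademacherSum S v T| :=
          sqrt_sum_sq_le_sum_powerset_abs_rademacherSum S v
      _ ≤ ∑ T ∈ S.powerset, (|h T - ∑ k ∈ T, w k| + |h T - ∑ k ∈ symmDiff T U, w k|) :=
          Finset.sum_le_sum fun T _ => htri T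
      _ = 2 * ∑ T ∈ S.powerset, |h T - ∑ k ∈ T, w k| := by
          rw [Finset.sum_add_distrib, hreindex, two_mul]
  linear_combination (1 / 2) * hkhintchine

theorem sum_ofReal_div_sqrt_card_le_sum_powerset {S U : Finset ι} (hU : U ⊆ S) {w : ι → ℝ}
    (hw : ∀ k ∈ U, 0 ≤ w k) {h : Finset ι → ℝ} (hflip : ∀ T, h (symmDiff T U) = h T) :
    2 ^ S.card * ∑ k ∈ U, ENNReal.ofReal (w k / (4 * √S.card)) ≤
      ∑ T ∈ S.powerset, ENNReal.ofReal |h T - ∑ k ∈ T, w k| := by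
  rw [← ENNReal.ofReal_sum_of_nonneg fun _ _ => abs_nonneg _,
    ← ENNReal.ofReal_sum_of_nonneg fun k hk => div_nonneg (hw k hk) (by positivity),
    ← Finset.sum_div, ← ENNReal.ofReal_ofNat 2, ← ENNReal.ofReal_pow zero_le_two,
    ← ENNReal.ofReal_mul (by positivity)]
  exact ENNReal.ofReal_le_ofReal (sum_div_sqrt_card_le_sum_powerset_abs_sub hU w hflip)

end Rademacher

section Sampling

theorem measurableSet_forall_notMem {κ X : Type*} [Countable κ] [MeasurableSpace X] {E : Set X}
    (hE : MeasurableSet E) :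
    MeasurableSet {x : κ → X | ∀ i, x i ∉ E} := by
  rw [Set.ofPred_forall]
  exact MeasurableSet.iInter fun i => (measurable_pi_apply i hE).compl

variable {ι κ X : Type*} [DecidableEq ι] [Fintype κ] [MeasurableSpace X] (ν : Measure X)
  [IsProbabilityMeasure ν]

theorem half_le_pi_forall_notMem {E : Set X} (hE : MeasurableSet E)
    (hνE : Fintype.card κ * ν E ≤ 1 / 2) :
    1 / 2 ≤ Measure.pi (fun _ : κ => ν) {x | ∀ i, x i ∉ E} := by
  have hcompl : {x : κ → X | ∀ i, x i ∉ E}ᶜ = ⋃ i, Function.eval i ⁻¹' E := by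
    ext x
    simp
  have hhit : Measure.pi (fun _ : κ => ν) {x | ∀ i, x i ∉ E}ᶜ ≤ 1 / 2 := calc
    _ ≤ ∑ i, Measure.pi (fun _ : κ => ν) (Function.eval i ⁻¹' E) := by
        rw [hcompl]
        exact measure_iUnion_fintype_le _ _
    _ = Fintype.card κ * ν E := by
        simp_rw [(measurePreserving_eval (fun _ : κ => ν) _).measure_preimage
          hE.nullMeasurableSet]
        rw [Finset.sum_const, Finset.card_univ, nsmul_eq_mul]
    _ ≤ 1 / 2 := hνE
  rw [one_div, ← ENNReal.one_sub_inv_two, ← one_div, ← compl_compl {x : κ → X | ∀ i, x i ∉ E},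
    prob_compl_eq_one_sub (measurableSet_forall_notMem hE).compl]
  exact tsub_le_tsub_left hhit 1

theorem sum_div_sqrt_card_le_sum_powerset_lintegral_abs_sub {S : Finset ι} {E : ι → Set X}
    (hE : ∀ k ∈ S, MeasurableSet (E k)) (hνE : ∀ k ∈ S, Fintype.card κ * ν (E k) ≤ 1 / 2)
    {w : ι → ℝ} (hw : ∀ k ∈ S, 0 ≤ w k) {h : Finset ι → (κ → X) → ℝ}
    (hmeas : ∀ T ⊆ S, Measurable (h T))
    (hflip : ∀ x T, ∀ U ⊆ S, (∀ k ∈ U, ∀ i, x i ∉ E k) → h (symmDiff T U) x = h T x) :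
    2 ^ S.card * ENNReal.ofReal ((∑ k ∈ S, w k) / (8 * √S.card)) ≤
      ∑ T ∈ S.powerset, ∫⁻ x, ENNReal.ofReal |h T x - ∑ k ∈ T, w k|
        ∂(Measure.pi fun _ : κ => ν) := by
  classical
  set v : ι → ℝ := fun k => w k / (4 * √S.card)
  have hv : ∀ k ∈ S, 0 ≤ v k := fun k hk => div_nonneg (hw k hk) (by positivity)
  have hhalf : ENNReal.ofReal ((∑ k ∈ S, w k) / (8 * √S.card)) =
      ∑ k ∈ S, ENNReal.ofReal (v k) * (1 / 2) := by
    have hsum : (∑ k ∈ S, w k) / (8 * √S.card) = (∑ k ∈ S, v k) * (1 / 2) := by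
      rw [← Finset.sum_div]
      ring
    rw [hsum, ENNReal.ofReal_mul (Finset.sum_nonneg hv), ENNReal.ofReal_sum_of_nonneg hv,
      Finset.sum_mul]
    simp
  have hmiss := fun k hk => measurableSet_forall_notMem (κ := κ) (hE k hk)
  calc 2 ^ S.card * ENNReal.ofReal ((∑ k ∈ S, w k) / (8 * √S.card))
      ≤ 2 ^ S.card * ∑ k ∈ S, ENNReal.ofReal (v k) *
          Measure.pi (fun _ : κ => ν) {x | ∀ i, x i ∉ E k} := by
        rw [hhalf]
        gcongr with k hk
        exact half_le_pi_forall_notMem ν (hE k hk) (hνE k hk)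
    _ = ∫⁻ x, 2 ^ S.card * ∑ k ∈ S, Set.indicator {x : κ → X | ∀ i, x i ∉ E k}
          (fun _ => ENNReal.ofReal (v k)) x ∂(Measure.pi fun _ : κ => ν) := by
        rw [lintegral_const_mul' _ _ (by simp), lintegral_finsetSum' _ fun k hk =>
          (measurable_const.indicator (hmiss k hk)).aemeasurable]
        exact congrArg _ (Finset.sum_congr rfl fun k hk =>
          (lintegral_indicator_const (hmiss k hk) _).symm)
    _ ≤ ∫⁻ x, ∑ T ∈ S.powerset, ENNReal.ofReal |h T x - ∑ k ∈ T, w k|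
          ∂(Measure.pi fun _ : κ => ν) := lintegral_mono fun x => by
        have hunseen := sum_ofReal_div_sqrt_card_le_sum_powerset
          (Finset.filter_subset (fun k => ∀ i, x i ∉ E k) S) (h := fun T => h T x)
          (fun k hk => hw k (Finset.mem_filter.1 hk).1) fun T =>
            hflip x T _ (Finset.filter_subset _ S) fun k hk => (Finset.mem_filter.1 hk).2
        simpa only [Finset.sum_filter, Set.indicator_apply, Set.mem_ofPred_eq] using hunseen
    _ = _ := lintegral_finsetSum' _ fun T hT =>
        (((hmeas T (Finset.mem_powerset.1 hT)).sub_const _).abs.ennreal_ofReal).aemeasurable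

/-- Assouad-type bound: averaging over the hypercube `T ⊆ S`, the sample misses each cell `E k`
with probability at least `1 / 2` and then carries no information on `k ∈ T`. -/
theorem sum_div_sqrt_card_le_minimaxRisk {d q n : ℕ} {pt ps : (Fin d → ℝ) → ℝ}
    {C : Set (((Fin d → ℝ) → ℝ) × ((Fin d → ℝ) → ℝ))} [IsProbabilityMeasure (densityMeasure d ps)]
    {S : Finset ι} {E : ι → Set (Fin d → ℝ)} (hE : ∀ k ∈ S, MeasurableSet (E k))
    (hνE : ∀ k ∈ S, n * densityMeasure d ps (E k) ≤ 1 / 2) {f : Finset ι → (Fin d → ℝ) → ℝ}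
    (hf : ∀ T ⊆ S, Measurable (f T)) (hC : ∀ T ⊆ S, (f T, ps) ∈ C)
    (hflip : ∀ y T, ∀ U ⊆ S, (∀ k ∈ U, y ∉ E k) → f (symmDiff T U) y = f T y) {w : ι → ℝ}
    (hw : ∀ k ∈ S, 0 ≤ w k) {I₀ : ℝ} (hI : ∀ T ⊆ S, moment d q pt (f T) = I₀ + ∑ k ∈ T, w k) :
    ENNReal.ofReal ((∑ k ∈ S, w k) / (8 * √S.card)) ≤ minimaxRisk d q n pt C := by
  refine le_iInf₂ fun H hH => ?_
  have haverage := sum_div_sqrt_card_le_sum_powerset_lintegral_abs_sub (κ := Fin n)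
    (densityMeasure d ps) hE (by simpa only [Fintype.card_fin] using hνE) hw
    (h := fun T x => H (x, fun i => f T (x i)) - I₀)
    (fun T hT => (hH.comp (measurable_id.prodMk (measurable_pi_lambda _ fun i =>
      (hf T hT).comp (measurable_pi_apply i)))).sub_const I₀)
    fun x T U hU hx => by
      simp only [hflip _ T U hU fun k hk => hx k hk _]
  have hsup : ∀ T ∈ S.powerset, ∫⁻ x, ENNReal.ofReal
      |H (x, fun i => f T (x i)) - I₀ - ∑ k ∈ T, w k|
        ∂(Measure.pi fun _ : Fin n => densityMeasure d ps) ≤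
      ⨆ v ∈ C, risk d q n pt H v.1 v.2 := fun T hT => by
    have hTS := Finset.mem_powerset.1 hT
    simp only [sub_sub, ← hI T hTS]
    exact le_iSup₂ (f := fun (v : ((Fin d → ℝ) → ℝ) × ((Fin d → ℝ) → ℝ)) (_ : v ∈ C) =>
      risk d q n pt H v.1 v.2) (f T, ps) (hC T hTS)
  have hle := haverage.trans (Finset.sum_le_card_nsmul _ _ _ hsup)
  rw [Finset.card_powerset, nsmul_eq_mul, Nat.cast_pow, Nat.cast_ofNat] at hle
  exact (ENNReal.mul_le_mul_iff_right (by simp) (by simp)).1 hle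

end Sampling

section SmoothDerivatives

variable {d : ℕ} {φ f : (Fin d → ℝ) → ℝ}

theorem contDiff_partialDeriv (hφ : ContDiff ℝ ∞ φ) (i : Fin d) :
    ContDiff ℝ ∞ (partialDeriv i φ) :=
  (hφ.fderiv_right (m := ∞) (by simp)).clm_apply contDiff_const

theorem partialDeriv_comm (hφ : ContDiff ℝ ∞ φ) (i j : Fin d) :
    partialDeriv i (partialDeriv j φ) = partialDeriv j (partialDeriv i φ) := by
  have hdiff : Differentiable ℝ (fderiv ℝ φ) :=
    (hφ.fderiv_right (m := ∞) (by simp)).differentiable (by simp)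
  funext x
  have hsnd : ∀ u v : Fin d → ℝ,
      fderiv ℝ (fun y => fderiv ℝ φ y u) x v = fderiv ℝ (fderiv ℝ φ) x v u := fun u v => by
    rw [fderiv_clm_apply (hdiff x) (differentiableAt_const u)]
    simp
  have hsymm : IsSymmSndFDerivAt ℝ φ x :=
    hφ.contDiffAt.isSymmSndFDerivAt (by simpa using ENat.LEInfty.out)
  exact (hsnd _ _).trans ((hsymm.eq _ _).trans (hsnd _ _).symm)

theorem integral_mul_partialDeriv (hf : ContDiff ℝ ∞ f) (hφ : ContDiff ℝ ∞ φ)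
    (hc : HasCompactSupport φ) (i : Fin d) :
    ∫ x, f x * partialDeriv i φ x = -∫ x, partialDeriv i f x * φ x := by
  have hc' : HasCompactSupport (partialDeriv i φ) := hc.fderiv_apply ℝ _
  exact integral_mul_fderiv_eq_neg_fderiv_mul_of_integrable
    (((contDiff_partialDeriv hf i).continuous.mul
      hφ.continuous).integrable_of_hasCompactSupport hc.mul_left)
    ((hf.continuous.mul
      (contDiff_partialDeriv hφ i).continuous).integrable_of_hasCompactSupport hc'.mul_left)
    ((hf.continuous.mul hφ.continuous).integrable_of_hasCompactSupport hc.mul_left)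
    (fun _ _ => hf.differentiable (by simp) _) (fun _ _ => hφ.differentiable (by simp) _)

/-- `D` is a composition of `n` partial derivatives, the form in which the order of `multiDeriv α`
is accessible to induction. -/
inductive IsIteratedPartialDeriv {d : ℕ} :
    ℕ → (((Fin d → ℝ) → ℝ) → (Fin d → ℝ) → ℝ) → Prop
  | id : IsIteratedPartialDeriv 0 id
  | partialDeriv_comp (i : Fin d) {n : ℕ} {D : ((Fin d → ℝ) → ℝ) → (Fin d → ℝ) → ℝ} :
      IsIteratedPartialDeriv n D → IsIteratedPartialDeriv (n + 1) (partialDeriv i ∘ D)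

theorem isIteratedPartialDeriv_multiDeriv (α : Fin d → ℕ) :
    IsIteratedPartialDeriv (∑ i, α i) (multiDeriv α) := by
  have hiterate : ∀ i a n (D : ((Fin d → ℝ) → ℝ) → (Fin d → ℝ) → ℝ),
      IsIteratedPartialDeriv n D →
        IsIteratedPartialDeriv (a + n) fun φ => (partialDeriv i)^[a] (D φ) := by
    intro i a n D hD
    induction a with
    | zero => simpa using hD
    | succ a ih =>
      rw [Nat.succ_add]
      simp only [Function.iterate_succ_apply']
      exact ih.partialDeriv_comp i
  have hfoldr : ∀ l : List (Fin d), IsIteratedPartialDeriv (l.map α).sum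
      fun φ => l.foldr (fun i g => (partialDeriv i)^[α i] g) φ := by
    intro l
    induction l with
    | nil => exact .id
    | cons i l ih => exact hiterate i (α i) _ _ ih
  rw [Fin.sum_univ_def]
  exact hfoldr _

namespace IsIteratedPartialDeriv

variable {n : ℕ} {D : ((Fin d → ℝ) → ℝ) → (Fin d → ℝ) → ℝ}

theorem contDiff (hD : IsIteratedPartialDeriv n D) (hφ : ContDiff ℝ ∞ φ) :
    ContDiff ℝ ∞ (D φ) := by
  induction hD with
  | id => exact hφ
  | partialDeriv_comp i _ ih => exact contDiff_partialDeriv ih i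

theorem tsupport_subset (hD : IsIteratedPartialDeriv n D) (φ : (Fin d → ℝ) → ℝ) :
    tsupport (D φ) ⊆ tsupport φ := by
  induction hD with
  | id => exact subset_rfl
  | partialDeriv_comp i _ ih => exact (tsupport_fderiv_apply_subset ℝ _).trans ih

theorem hasCompactSupport (hD : IsIteratedPartialDeriv n D) (hc : HasCompactSupport φ) :
    HasCompactSupport (D φ) :=
  hc.of_isClosed_subset (isClosed_tsupport _) (hD.tsupport_subset φ)

theorem apply_partialDeriv (hD : IsIteratedPartialDeriv n D) (hφ : ContDiff ℝ ∞ φ) (i : Fin d) :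
    D (partialDeriv i φ) = partialDeriv i (D φ) := by
  induction hD with
  | id => rfl
  | partialDeriv_comp j hD ih =>
    exact (congrArg (partialDeriv j) ih).trans (partialDeriv_comm (hD.contDiff hφ) j i)

theorem integral_mul (hD : IsIteratedPartialDeriv n D) (hf : ContDiff ℝ ∞ f)
    (hφ : ContDiff ℝ ∞ φ) (hc : HasCompactSupport φ) :
    ∫ x, f x * D φ x = (-1) ^ n * ∫ x, D f x * φ x := by
  induction hD generalizing f with
  | id => simp
  | partialDeriv_comp i hD ih =>
    rw [pow_succ, mul_assoc, neg_one_mul, mul_neg]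
    calc ∫ x, f x * partialDeriv i _ x
        = -∫ x, partialDeriv i f x * _ :=
          integral_mul_partialDeriv hf (hD.contDiff hφ) (hD.hasCompactSupport hc) i
      _ = _ := by
          rw [ih (contDiff_partialDeriv hf i), hD.apply_partialDeriv hf]
          rfl

end IsIteratedPartialDeriv

theorem hasWeakDeriv_multiDeriv (hf : ContDiff ℝ ∞ f) (α : Fin d → ℕ) :
    HasWeakDeriv α f (multiDeriv α f) := by
  intro φ hφ hc hsupp
  have hD := isIteratedPartialDeriv_multiDeriv α
  have hcube : ∀ g ψ : (Fin d → ℝ) → ℝ, tsupport ψ ⊆ tsupport φ →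
      ∫ x, g x * ψ x ∂(cubeVolume d) = ∫ x, g x * ψ x := by
    refine fun g ψ hψ => setIntegral_eq_integral_of_forall_compl_eq_zero fun x hx => ?_
    have hxψ : x ∉ tsupport ψ := fun h => hx (interior_subset (hsupp (hψ h)))
    rw [image_eq_zero_of_notMem_tsupport hxψ, mul_zero]
  rw [hcube _ _ (hD.tsupport_subset φ), hcube _ _ subset_rfl, hD.integral_mul hf hφ hc]

end SmoothDerivatives

section Sobolev

variable {d s : ℕ} {p : ℝ} {f : (Fin d → ℝ) → ℝ}

theorem isCompact_cube : IsCompact (cube d) := isCompact_Icc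

instance : IsProbabilityMeasure (cubeVolume d) where
  measure_univ := by
    rw [cubeVolume, Measure.restrict_apply_univ, cube, Real.volume_Icc_pi]
    simp

theorem memLp_cubeVolume_of_continuous (hf : Continuous f) (r : ℝ≥0∞) :
    MemLp f r (cubeVolume d) := by
  obtain ⟨C, hC⟩ := isCompact_cube.exists_bound_of_continuousOn hf.continuousOn
  exact .of_bound hf.aestronglyMeasurable C (ae_restrict_of_forall_mem measurableSet_Icc hC)

theorem memSobolev_of_contDiff (hf : ContDiff ℝ ∞ f) : MemSobolev d s p f :=
  ⟨memLp_cubeVolume_of_continuous hf.continuous _, fun α _ => ⟨multiDeriv α f,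
    memLp_cubeVolume_of_continuous ((isIteratedPartialDeriv_multiDeriv α).contDiff hf).continuous _,
    hasWeakDeriv_multiDeriv hf α⟩⟩

theorem weakDerivNorm_le_eLpNorm_multiDeriv (hf : ContDiff ℝ ∞ f) (α : Fin d → ℕ) :
    weakDerivNorm p α f ≤ eLpNorm (multiDeriv α f) (ENNReal.ofReal p) (cubeVolume d) :=
  have hcont := ((isIteratedPartialDeriv_multiDeriv α).contDiff hf).continuous
  iInf_le_of_le _ (iInf₂_le (memLp_cubeVolume_of_continuous hcont _) (hasWeakDeriv_multiDeriv hf α))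

theorem sobolevNorm_le_sum_weakDerivNorm (hp : 1 ≤ p) (f : (Fin d → ℝ) → ℝ) :
    sobolevNorm d s p f ≤ ∑ α ∈ multiIndices d s, weakDerivNorm p α f := by
  have hp0 : 0 < p := zero_lt_one.trans_le hp
  calc sobolevNorm d s p f
      ≤ ∑ α ∈ multiIndices d s, (weakDerivNorm p α f ^ p) ^ (1 / p) :=
        Finset.le_sum_of_subadditive (fun t : ℝ≥0∞ => t ^ (1 / p))
          (ENNReal.zero_rpow_of_pos (one_div_pos.2 hp0)).le
          (fun a b => ENNReal.rpow_add_le_add_rpow a b (one_div_nonneg.2 hp0.le)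
            ((div_le_one hp0).2 hp)) _ _
    _ = ∑ α ∈ multiIndices d s, weakDerivNorm p α f := by
        simp_rw [← ENNReal.rpow_mul, mul_one_div_cancel hp0.ne', ENNReal.rpow_one]

end Sobolev

section Grid

variable {d m : ℕ}

/-- The affine coordinate `m x - k` that maps the cell `∏ [k i / m, (k i + 1) / m]` of the grid of
mesh `1 / m` onto the unit cube. -/
def cellCoord (k : Fin d → Fin m) (x : Fin d → ℝ) : Fin d → ℝ :=
  (m : ℝ) • x - fun i => (k i : ℝ)

theorem continuous_cellCoord (k : Fin d → Fin m) : Continuous (cellCoord k) := by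
  unfold cellCoord
  fun_prop

theorem contDiff_cellCoord (k : Fin d → Fin m) : ContDiff ℝ ∞ (cellCoord k) := by
  unfold cellCoord
  fun_prop

theorem map_cellCoord_volume (hm : m ≠ 0) (k : Fin d → Fin m) :
    Measure.map (cellCoord k) volume = ENNReal.ofReal ((m : ℝ) ^ d)⁻¹ • volume := by
  have hcomp : cellCoord k = (fun x => x - fun i => (k i : ℝ)) ∘ fun x => (m : ℝ) • x := rfl
  rw [hcomp, ← Measure.map_map (by fun_prop) (by fun_prop),
    Measure.map_addHaar_smul _ (Nat.cast_ne_zero.2 hm), Measure.map_smul,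
    (measurePreserving_sub_right volume _).map_eq]
  simp

theorem volume_cellCoord_preimage (hm : m ≠ 0) (k : Fin d → Fin m) {K : Set (Fin d → ℝ)}
    (hK : MeasurableSet K) :
    volume (cellCoord k ⁻¹' K) = ENNReal.ofReal ((m : ℝ) ^ d)⁻¹ * volume K := by
  rw [← Measure.map_apply (continuous_cellCoord k).measurable hK, map_cellCoord_volume hm,
    Measure.smul_apply, smul_eq_mul]

theorem lintegral_comp_cellCoord (hm : m ≠ 0) (k : Fin d → Fin m) {g : (Fin d → ℝ) → ℝ≥0∞}
    (hg : Measurable g) :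
    ∫⁻ x, g (cellCoord k x) = ENNReal.ofReal ((m : ℝ) ^ d)⁻¹ * ∫⁻ x, g x := by
  rw [← lintegral_map hg (continuous_cellCoord k).measurable, map_cellCoord_volume hm,
    lintegral_smul_measure, smul_eq_mul]

theorem interior_cube : interior (cube d) = Set.pi Set.univ fun _ => Set.Ioo (0 : ℝ) 1 := by
  rw [cube, ← Set.pi_univ_Icc, interior_pi_set Set.finite_univ]
  simp

theorem volume_interior_cube : volume (interior (cube d)) = 1 := by
  rw [interior_cube, Real.volume_pi_Ioo]
  simp

theorem floor_mul_eq_of_cellCoord_mem {k : Fin d → Fin m} {x : Fin d → ℝ}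
    (hx : cellCoord k x ∈ interior (cube d)) (i : Fin d) : ⌊(m : ℝ) * x i⌋₊ = k i := by
  rw [interior_cube] at hx
  obtain ⟨hpos, hlt⟩ : 0 < m * x i - k i ∧ m * x i - k i < 1 := hx i (Set.mem_univ i)
  rw [Nat.floor_eq_iff (by linarith [Nat.cast_nonneg (α := ℝ) (k i : ℕ)])]
  constructor <;> linarith

theorem eq_of_cellCoord_mem {k k' : Fin d → Fin m} {x : Fin d → ℝ}
    (hx : cellCoord k x ∈ interior (cube d)) (hx' : cellCoord k' x ∈ interior (cube d)) :
    k = k' :=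
  funext fun i => Fin.ext <| by
    rw [← floor_mul_eq_of_cellCoord_mem hx i, floor_mul_eq_of_cellCoord_mem hx' i]

theorem cellCoord_preimage_cube_subset (k : Fin d → Fin m) : cellCoord k ⁻¹' cube d ⊆ cube d := by
  intro x hx
  have hcoord : ∀ i, 0 ≤ m * x i - k i ∧ m * x i - k i ≤ 1 := fun i => ⟨hx.1 i, hx.2 i⟩
  have hm : Fin d → (0 : ℝ) < m := fun i => Nat.cast_pos.2 (Fin.pos (k i))
  have hk : ∀ i, ((k i : ℕ) : ℝ) + 1 ≤ m := fun i => by exact_mod_cast (k i).2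
  have hk0 : ∀ i, (0 : ℝ) ≤ (k i : ℕ) := fun i => Nat.cast_nonneg _
  refine ⟨fun i => ?_, fun i => ?_⟩
  · exact nonneg_of_mul_nonneg_right (by linarith [hcoord i, hk0 i]) (hm i)
  · refine le_of_mul_le_mul_left ?_ (hm i)
    rw [Pi.one_apply]
    linarith [hcoord i, hk i]

theorem support_comp_cellCoord_subsingleton {M : Type*} [Zero M] {ψ : (Fin d → ℝ) → M}
    (hψ : Function.support ψ ⊆ interior (cube d)) (x : Fin d → ℝ) :
    (Function.support fun k : Fin d → Fin m => ψ (cellCoord k x)).Subsingleton :=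
  fun _ hk _ hk' => eq_of_cellCoord_mem (hψ hk) (hψ hk')

theorem eLpNorm_sum_comp_cellCoord (hm : m ≠ 0) {p : ℝ} (hp : 0 < p) {ψ : (Fin d → ℝ) → ℝ}
    (hψ : Function.support ψ ⊆ interior (cube d)) (hmeas : Measurable ψ)
    (T : Finset (Fin d → Fin m)) :
    eLpNorm (fun x => ∑ k ∈ T, ψ (cellCoord k x)) (ENNReal.ofReal p) volume =
      ENNReal.ofReal ((T.card / (m : ℝ) ^ d) ^ (1 / p)) *
        eLpNorm ψ (ENNReal.ofReal p) volume := by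
  have hp0 : ENNReal.ofReal p ≠ 0 := by simpa using hp
  have hpow : Measurable fun x => ‖ψ x‖ₑ ^ p := hmeas.enorm.pow_const p
  have hlintegral : ∫⁻ x, ‖∑ k ∈ T, ψ (cellCoord k x)‖ₑ ^ p =
      ENNReal.ofReal (T.card / (m : ℝ) ^ d) * ∫⁻ x, ‖ψ x‖ₑ ^ p := calc
    _ = ∫⁻ x, ∑ k ∈ T, ‖ψ (cellCoord k x)‖ₑ ^ p := lintegral_congr fun x =>
        map_sum_of_subsingleton_support (F := fun y : ℝ => ‖y‖ₑ ^ p)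
          (by simp [hp]) (support_comp_cellCoord_subsingleton hψ x) T
    _ = ∑ k ∈ T, ∫⁻ x, ‖ψ (cellCoord k x)‖ₑ ^ p :=
        lintegral_finsetSum _ fun k _ => hpow.comp (continuous_cellCoord k).measurable
    _ = _ := by
        simp_rw [lintegral_comp_cellCoord hm _ hpow]
        rw [Finset.sum_const, nsmul_eq_mul, ← mul_assoc, ← ENNReal.ofReal_natCast,
          ← ENNReal.ofReal_mul (Nat.cast_nonneg _), ← div_eq_mul_inv]
  rw [eLpNorm_eq_lintegral_rpow_enorm_toReal hp0 ENNReal.ofReal_ne_top,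
    eLpNorm_eq_lintegral_rpow_enorm_toReal hp0 ENNReal.ofReal_ne_top, ENNReal.toReal_ofReal hp.le,
    hlintegral, ENNReal.mul_rpow_of_nonneg _ _ (by positivity),
    ENNReal.ofReal_rpow_of_nonneg (by positivity) (by positivity)]

end Grid

section BumpSum

variable {d m : ℕ}

/-- `ψ` is a smooth nonnegative bump supported in the open unit cube, the profile that is copied
into the cells of the grid. -/
structure IsCubeBump (ψ : (Fin d → ℝ) → ℝ) : Prop where
  contDiff : ContDiff ℝ ∞ ψ
  tsupport_subset : tsupport ψ ⊆ interior (cube d)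
  nonneg : ∀ x, 0 ≤ ψ x

theorem exists_isCubeBump (d : ℕ) {δ : ℝ} (hδ : 0 < δ) :
    ∃ ψ : (Fin d → ℝ) → ℝ, IsCubeBump ψ ∧ 1 - δ ≤ volume.real (ψ ⁻¹' {1}) := by
  have hlt : ENNReal.ofReal (1 - δ) < volume (interior (cube d)) := by
    rw [volume_interior_cube, ENNReal.ofReal_lt_one]
    linarith
  obtain ⟨K, hKcube, hK, hvol⟩ := isOpen_interior.exists_lt_isCompact hlt
  obtain ⟨K', hK', hKK', hK'cube⟩ := exists_compact_between hK isOpen_interior hKcube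
  obtain ⟨ψ, hone, hzero, hψ⟩ := exists_contMDiffMap_one_nhds_of_subset_interior (n := ⊤)
    (modelWithCornersSelf ℝ (Fin d → ℝ)) hK.isClosed hKK'
  have hsupp : tsupport ψ ⊆ K' :=
    closure_minimal (fun x hx => by_contra fun h => hx (hzero x h)) hK'.isClosed
  have hplateau : volume (ψ ⁻¹' {1}) ≠ ⊤ := ne_top_of_le_ne_top hK'.measure_ne_top <|
    measure_mono fun x hx => hsupp (subset_tsupport ψ fun h => one_ne_zero (hx.symm.trans h))
  exact ⟨ψ, ⟨ψ.contMDiff.contDiff, hsupp.trans hK'cube, fun x => (hψ x).1⟩,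
    (ENNReal.ofReal_le_iff_le_toReal hplateau).1 <|
      hvol.le.trans (measure_mono fun x hx => hone.self_of_nhdsSet x hx)⟩

theorem IsCubeBump.hasCompactSupport {ψ : (Fin d → ℝ) → ℝ} (hψ : IsCubeBump ψ) :
    HasCompactSupport ψ :=
  isCompact_cube.of_isClosed_subset (isClosed_tsupport ψ)
    (hψ.tsupport_subset.trans interior_subset)

theorem IsCubeBump.support_subset {ψ : (Fin d → ℝ) → ℝ} (hψ : IsCubeBump ψ) :
    Function.support ψ ⊆ interior (cube d) :=
  (subset_tsupport ψ).trans hψ.tsupport_subset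

theorem IsCubeBump.plateau_subset {ψ : (Fin d → ℝ) → ℝ} (hψ : IsCubeBump ψ) :
    ψ ⁻¹' {1} ⊆ interior (cube d) := fun _ hx => hψ.support_subset fun h =>
  one_ne_zero (hx.symm.trans h)

/-- The grid function `M + A ∑ k ∈ T, ψ (m x - k)`: a constant plus a bump of height `A` in each
cell of `T`. -/
def bumpSum (M A : ℝ) (ψ : (Fin d → ℝ) → ℝ) (T : Finset (Fin d → Fin m)) (x : Fin d → ℝ) : ℝ :=
  M + A * ∑ k ∈ T, ψ (cellCoord k x)

variable {M A : ℝ} {ψ : (Fin d → ℝ) → ℝ}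

theorem contDiff_bumpSum (hψ : ContDiff ℝ ∞ ψ) (T : Finset (Fin d → Fin m)) :
    ContDiff ℝ ∞ (bumpSum M A ψ T) :=
  contDiff_const.add (contDiff_const.mul (ContDiff.sum fun k _ => hψ.comp (contDiff_cellCoord k)))

theorem partialDeriv_bumpSum (hψ : ContDiff ℝ ∞ ψ) (T : Finset (Fin d → Fin m)) (i : Fin d) :
    partialDeriv i (bumpSum M A ψ T) = bumpSum 0 (A * m) (partialDeriv i ψ) T := by
  funext x
  have hcell : ∀ k ∈ T, HasFDerivAt (fun x => ψ (cellCoord k x))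
      ((fderiv ℝ ψ (cellCoord k x)).comp ((m : ℝ) • ContinuousLinearMap.id ℝ (Fin d → ℝ))) x :=
    fun k _ => (hψ.differentiable (by simp) _).hasFDerivAt.comp x
      (((hasFDerivAt_id x).const_smul (m : ℝ)).sub_const _)
  have hsum : HasFDerivAt (bumpSum M A ψ T) _ x :=
    ((HasFDerivAt.fun_sum hcell).const_mul A).const_add M
  rw [partialDeriv, hsum.fderiv]
  simp [bumpSum, partialDeriv, Finset.mul_sum, mul_assoc]

theorem IsIteratedPartialDeriv.apply_bumpSum {n : ℕ}
    {D : ((Fin d → ℝ) → ℝ) → (Fin d → ℝ) → ℝ} (hD : IsIteratedPartialDeriv n D)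
    (hψ : ContDiff ℝ ∞ ψ) (T : Finset (Fin d → Fin m)) :
    D (bumpSum M A ψ T) = bumpSum (if n = 0 then M else 0) (A * m ^ n) (D ψ) T := by
  induction hD with
  | id => simp
  | partialDeriv_comp i hD ih =>
    rw [Function.comp_apply, ih, partialDeriv_bumpSum (hD.contDiff hψ)]
    simp [pow_succ, mul_assoc]

theorem eLpNorm_bumpSum_le (hm : m ≠ 0) {p : ℝ} (hp : 1 ≤ p) (hM : 0 ≤ M) (hA : 0 ≤ A)
    (hψ : Continuous ψ) (hsupp : Function.support ψ ⊆ interior (cube d))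
    (T : Finset (Fin d → Fin m)) :
    eLpNorm (bumpSum M A ψ T) (ENNReal.ofReal p) (cubeVolume d) ≤
      ENNReal.ofReal M + ENNReal.ofReal (A * (T.card / (m : ℝ) ^ d) ^ (1 / p)) *
        eLpNorm ψ (ENNReal.ofReal p) volume := by
  have hp0 : 0 < p := zero_lt_one.trans_le hp
  have hcont : Continuous fun x => ∑ k ∈ T, ψ (cellCoord k x) :=
    continuous_finsetSum _ fun k _ => hψ.comp (continuous_cellCoord k)
  calc eLpNorm (bumpSum M A ψ T) (ENNReal.ofReal p) (cubeVolume d)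
      ≤ eLpNorm (fun _ => M) (ENNReal.ofReal p) (cubeVolume d) +
          eLpNorm (A • fun x => ∑ k ∈ T, ψ (cellCoord k x)) (ENNReal.ofReal p) (cubeVolume d) :=
        eLpNorm_add_le aestronglyMeasurable_const (hcont.const_smul A).aestronglyMeasurable
          (ENNReal.one_le_ofReal.2 hp)
    _ ≤ ENNReal.ofReal M + ENNReal.ofReal A *
          eLpNorm (fun x => ∑ k ∈ T, ψ (cellCoord k x)) (ENNReal.ofReal p) volume := by
        rw [eLpNorm_const' _ (by simpa using hp0) ENNReal.ofReal_ne_top, measure_univ,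
          ENNReal.one_rpow, mul_one, eLpNorm_const_smul, Real.enorm_of_nonneg hM,
          Real.enorm_of_nonneg hA]
        gcongr
        exact Measure.restrict_le_self
    _ = _ := by
        rw [eLpNorm_sum_comp_cellCoord hm hp0 hsupp hψ.measurable, ENNReal.ofReal_mul hA, mul_assoc]

theorem IsIteratedPartialDeriv.eLpNorm_bumpSum_le {n s : ℕ}
    {D : ((Fin d → ℝ) → ℝ) → (Fin d → ℝ) → ℝ} (hD : IsIteratedPartialDeriv n D) (hns : n ≤ s)
    (hm : m ≠ 0) {p : ℝ} (hp : 1 ≤ p) (hM : 0 ≤ M) (hA : 0 ≤ A) (hψ : IsCubeBump ψ)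
    (T : Finset (Fin d → Fin m)) :
    eLpNorm (D (bumpSum M A ψ T)) (ENNReal.ofReal p) (cubeVolume d) ≤
      ENNReal.ofReal M + ENNReal.ofReal (A * m ^ s * (T.card / (m : ℝ) ^ d) ^ (1 / p)) *
        eLpNorm (D ψ) (ENNReal.ofReal p) volume := by
  have hm1 : (1 : ℝ) ≤ m := Nat.one_le_cast.2 (Nat.one_le_iff_ne_zero.2 hm)
  calc eLpNorm (D (bumpSum M A ψ T)) (ENNReal.ofReal p) (cubeVolume d)
      ≤ ENNReal.ofReal (if n = 0 then M else 0) +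
          ENNReal.ofReal (A * m ^ n * (T.card / (m : ℝ) ^ d) ^ (1 / p)) *
            eLpNorm (D ψ) (ENNReal.ofReal p) volume := by
        rw [hD.apply_bumpSum hψ.contDiff]
        exact CovShift.eLpNorm_bumpSum_le hm hp (by positivity) (by positivity)
          (hD.contDiff hψ.contDiff).continuous
          ((subset_tsupport _).trans ((hD.tsupport_subset ψ).trans hψ.tsupport_subset)) T
    _ ≤ _ := by
        gcongr
        split_ifs <;> simp [hM]

theorem exists_sobolevNorm_bumpSum_le (hψ : IsCubeBump ψ) (s : ℕ) {p : ℝ} (hp : 1 ≤ p) :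
    ∃ C : ℝ, 0 < C ∧ ∀ {m : ℕ}, m ≠ 0 → ∀ {M A : ℝ}, 0 ≤ M → 0 ≤ A →
      ∀ T : Finset (Fin d → Fin m), sobolevNorm d s p (bumpSum M A ψ T) ≤
        ENNReal.ofReal (C * (M + A * m ^ s * (T.card / (m : ℝ) ^ d) ^ (1 / p))) := by
  have hD := fun α : Fin d → ℕ => isIteratedPartialDeriv_multiDeriv α
  have hLp : ∀ α, eLpNorm (multiDeriv α ψ) (ENNReal.ofReal p) volume ≠ ⊤ := fun α =>
    (((hD α).contDiff hψ.contDiff).continuous.memLp_of_hasCompactSupport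
      ((hD α).hasCompactSupport hψ.hasCompactSupport)).eLpNorm_ne_top
  set b : (Fin d → ℕ) → ℝ := fun α => (eLpNorm (multiDeriv α ψ) (ENNReal.ofReal p) volume).toReal
  have hb : ∀ α, 0 ≤ b α := fun α => ENNReal.toReal_nonneg
  refine ⟨∑ α ∈ multiIndices d s, (1 + b α), Finset.sum_pos (fun α _ => by linarith [hb α])
    ⟨0, by simp [multiIndices]⟩, fun {m} hm {M A} hM hA T => ?_⟩
  set V : ℝ := A * m ^ s * (T.card / (m : ℝ) ^ d) ^ (1 / p)
  have hV : 0 ≤ V := by positivity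
  have hderiv : ∀ α ∈ multiIndices d s, weakDerivNorm p α (bumpSum M A ψ T) ≤
      ENNReal.ofReal ((1 + b α) * (M + V)) := fun α hα => calc
    _ ≤ ENNReal.ofReal M + ENNReal.ofReal V * ENNReal.ofReal (b α) := by
        rw [ENNReal.ofReal_toReal (hLp α)]
        exact (weakDerivNorm_le_eLpNorm_multiDeriv (contDiff_bumpSum hψ.contDiff T) α).trans
          ((hD α).eLpNorm_bumpSum_le (Finset.mem_filter.1 hα).2 hm hp hM hA hψ T)
    _ ≤ ENNReal.ofReal ((1 + b α) * (M + V)) := by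
        rw [← ENNReal.ofReal_mul hV, ← ENNReal.ofReal_add hM (mul_nonneg hV (hb α))]
        apply ENNReal.ofReal_le_ofReal
        linear_combination hV + mul_nonneg (hb α) hM
  rw [Finset.sum_mul, ENNReal.ofReal_sum_of_nonneg fun α _ => mul_nonneg (by linarith [hb α])
    (add_nonneg hM hV)]
  exact (sobolevNorm_le_sum_weakDerivNorm hp _).trans (Finset.sum_le_sum hderiv)

end BumpSum

section Density

variable {d m : ℕ} {ρ : (Fin d → ℝ) → ℝ} {b : ℝ}

theorem IsDensity.isProbabilityMeasure (hρ : IsDensity d ρ) :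
    IsProbabilityMeasure (densityMeasure d ρ) where
  measure_univ := by
    rw [densityMeasure, withDensity_apply _ MeasurableSet.univ, Measure.restrict_univ,
      hρ.lintegral_eq_one]

theorem densityMeasure_le (hb : ∀ x ∈ cube d, ρ x ≤ b) {E : Set (Fin d → ℝ)}
    (hE : MeasurableSet E) : densityMeasure d ρ E ≤ ENNReal.ofReal b * cubeVolume d E := by
  rw [densityMeasure, withDensity_apply _ hE, ← setLIntegral_const]
  refine lintegral_mono_ae (ae_restrict_of_ae ?_)
  exact ae_restrict_of_forall_mem measurableSet_Icc fun x hx => ENNReal.ofReal_le_ofReal (hb x hx)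

theorem IsDensity.one_le_of_le (hρ : IsDensity d ρ) (hb : ∀ x ∈ cube d, ρ x ≤ b) : 1 ≤ b := by
  have := hρ.isProbabilityMeasure
  simpa only [measure_univ, mul_one, ENNReal.one_le_ofReal] using
    densityMeasure_le hb MeasurableSet.univ

theorem integrable_densityMeasure_of_continuous [IsFiniteMeasure (densityMeasure d ρ)]
    {f : (Fin d → ℝ) → ℝ} (hf : Continuous f) : Integrable f (densityMeasure d ρ) := by
  obtain ⟨C, hC⟩ := isCompact_cube.exists_bound_of_continuousOn hf.continuousOn
  exact .of_bound hf.aestronglyMeasurable C <| (withDensity_absolutelyContinuous _ _).ae_le <|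
    ae_restrict_of_forall_mem measurableSet_Icc hC

theorem one_sub_mul_le_sum_densityMeasure_cellCoord_preimage (hρ : IsDensity d ρ)
    (hb : ∀ x ∈ cube d, ρ x ≤ b) (hm : m ≠ 0) {K : Set (Fin d → ℝ)} (hK : MeasurableSet K)
    (hKcube : K ⊆ interior (cube d)) :
    1 - b * (1 - volume.real K) ≤
      ∑ k : Fin d → Fin m, (densityMeasure d ρ).real (cellCoord k ⁻¹' K) := by
  have := hρ.isProbabilityMeasure
  have hdisj : Pairwise (Function.onFun Disjoint fun k : Fin d → Fin m => cellCoord k ⁻¹' K) :=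
    fun k k' hne => Set.disjoint_left.2 fun x hx hx' =>
      hne (eq_of_cellCoord_mem (hKcube hx) (hKcube hx'))
  have hmeas : ∀ k : Fin d → Fin m, MeasurableSet (cellCoord k ⁻¹' K) :=
    fun k => (continuous_cellCoord k).measurable hK
  set W : Set (Fin d → ℝ) := ⋃ k : Fin d → Fin m, cellCoord k ⁻¹' K
  have hW : MeasurableSet W := .iUnion hmeas
  have hWcube : W ⊆ cube d := Set.iUnion_subset fun k =>
    (Set.preimage_mono (hKcube.trans interior_subset)).trans (cellCoord_preimage_cube_subset k)
  have hvolume : (cubeVolume d).real W = volume.real K := by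
    rw [cubeVolume, measureReal_restrict_apply hW, Set.inter_eq_left.2 hWcube, measureReal_def,
      measure_iUnion hdisj hmeas, tsum_fintype]
    simp [volume_cellCoord_preimage hm _ hK, hm, measureReal_def]
  have hcompl : (densityMeasure d ρ).real Wᶜ ≤ b * (cubeVolume d).real Wᶜ := by
    have hle := ENNReal.toReal_mono (by finiteness) (densityMeasure_le hb hW.compl)
    rwa [ENNReal.toReal_mul,
      ENNReal.toReal_ofReal (zero_le_one.trans (hρ.one_le_of_le hb))] at hle
  rw [probReal_compl_eq_one_sub hW, probReal_compl_eq_one_sub hW, hvolume] at hcompl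
  rw [← measureReal_iUnion_fintype hdisj hmeas]
  linarith

theorem exists_isCubeBump_half_le_sum (d : ℕ) {β : ℝ} (hβ : 0 < β) :
    ∃ ψ : (Fin d → ℝ) → ℝ, IsCubeBump ψ ∧ ∀ {m : ℕ}, m ≠ 0 → ∀ {ρ : (Fin d → ℝ) → ℝ},
      IsDensity d ρ → (∀ x ∈ cube d, ρ x ≤ β) →
        1 / 2 ≤ ∑ k : Fin d → Fin m, (densityMeasure d ρ).real (cellCoord k ⁻¹' (ψ ⁻¹' {1})) := by
  obtain ⟨ψ, hψ, hplateau⟩ := exists_isCubeBump d (δ := 1 / (2 * β)) (by positivity)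
  refine ⟨ψ, hψ, fun {m} hm {ρ} hρ hρβ => ?_⟩
  have hmass := one_sub_mul_le_sum_densityMeasure_cellCoord_preimage hρ hρβ hm
    (hψ.contDiff.continuous.measurable (measurableSet_singleton 1)) hψ.plateau_subset
  have hmissed : β * (1 - volume.real (ψ ⁻¹' {1})) ≤ β * (1 / (2 * β)) := by
    gcongr
    linarith
  have hδ : β * (1 / (2 * β)) = 1 / 2 := by field_simp
  linarith

end Density

section Moments

variable {d m : ℕ} {pt ψ : (Fin d → ℝ) → ℝ} {M A : ℝ}

/-- The amount by which a bump of height `A` in the cell `k` raises the `q`-th target moment of the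
constant `M`. -/
noncomputable def bumpMoment (q : ℕ) (pt : (Fin d → ℝ) → ℝ) (M A : ℝ) (ψ : (Fin d → ℝ) → ℝ)
    (k : Fin d → Fin m) : ℝ :=
  ∫ x, ((M + A * ψ (cellCoord k x)) ^ q - M ^ q) ∂(densityMeasure d pt)

theorem bumpSum_pow (hψ : IsCubeBump ψ) (q : ℕ) (T : Finset (Fin d → Fin m)) (x : Fin d → ℝ) :
    bumpSum M A ψ T x ^ q = M ^ q + ∑ k ∈ T, ((M + A * ψ (cellCoord k x)) ^ q - M ^ q) := by
  rw [← map_sum_of_subsingleton_support (F := fun t : ℝ => (M + A * t) ^ q - M ^ q) (by simp)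
    (support_comp_cellCoord_subsingleton hψ.support_subset x) T]
  simp [bumpSum]

variable [IsProbabilityMeasure (densityMeasure d pt)]

theorem integrable_bumpMoment (hψ : IsCubeBump ψ) (q : ℕ) (k : Fin d → Fin m) :
    Integrable (fun x => (M + A * ψ (cellCoord k x)) ^ q - M ^ q) (densityMeasure d pt) := by
  have hcomp := hψ.contDiff.continuous.comp (continuous_cellCoord k)
  exact integrable_densityMeasure_of_continuous
    (((continuous_const.add (continuous_const.mul hcomp)).pow q).sub continuous_const)

theorem moment_bumpSum (hψ : IsCubeBump ψ) (q : ℕ) (T : Finset (Fin d → Fin m)) :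
    moment d q pt (bumpSum M A ψ T) = M ^ q + ∑ k ∈ T, bumpMoment q pt M A ψ k := by
  have hintegrable :=
    fun k : Fin d → Fin m => integrable_bumpMoment (pt := pt) (M := M) (A := A) hψ q k
  simp only [moment, bumpSum_pow hψ, bumpMoment]
  rw [integral_add (integrable_const _) (integrable_finsetSum _ fun k _ => hintegrable k),
    integral_finsetSum _ fun k _ => hintegrable k]
  simp

theorem mul_densityMeasure_plateau_le_bumpMoment (hψ : IsCubeBump ψ) (q : ℕ) (hM : 0 ≤ M)
    (hA : 0 ≤ A) (k : Fin d → Fin m) :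
    ((M + A) ^ q - M ^ q) * (densityMeasure d pt).real (cellCoord k ⁻¹' (ψ ⁻¹' {1})) ≤
      bumpMoment q pt M A ψ k := by
  have hplateau : MeasurableSet (cellCoord k ⁻¹' (ψ ⁻¹' {1})) :=
    (continuous_cellCoord k).measurable
      (hψ.contDiff.continuous.measurable (measurableSet_singleton 1))
  rw [mul_comm, ← smul_eq_mul, ← integral_indicator_const _ hplateau]
  refine integral_mono ((integrable_const _).indicator hplateau) (integrable_bumpMoment hψ q k) ?_
  refine Set.indicator_le' (fun x hx => ?_) fun x _ => ?_
  · have hone : ψ (cellCoord k x) = 1 := hx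
    rw [hone, mul_one]
  · exact sub_nonneg.2 (pow_le_pow_left₀ hM
      (le_add_of_nonneg_right (mul_nonneg hA (hψ.nonneg _))) q)

end Moments

section BumpLowerBound

variable {d q m n : ℕ} {pt ps ψ : (Fin d → ℝ) → ℝ} {bu M A : ℝ}
  {C : Set (((Fin d → ℝ) → ℝ) × ((Fin d → ℝ) → ℝ))}

theorem mul_densityMeasure_cell_le_half (hm : m ≠ 0) (hps : ∀ x ∈ cube d, ps x ≤ bu)
    (hmn : 2 * bu * n ≤ (m : ℝ) ^ d) (k : Fin d → Fin m) :
    n * densityMeasure d ps (cellCoord k ⁻¹' interior (cube d)) ≤ 1 / 2 := by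
  have hmeas : MeasurableSet (interior (cube d)) := isOpen_interior.measurableSet
  have hcell : cubeVolume d (cellCoord k ⁻¹' interior (cube d)) ≤
      ENNReal.ofReal ((m : ℝ) ^ d)⁻¹ := by
    refine (Measure.restrict_apply_le _ _).trans_eq ?_
    rw [volume_cellCoord_preimage hm k hmeas, volume_interior_cube, mul_one]
  calc n * densityMeasure d ps (cellCoord k ⁻¹' interior (cube d))
      ≤ ENNReal.ofReal n * (ENNReal.ofReal bu * ENNReal.ofReal ((m : ℝ) ^ d)⁻¹) := by
        rw [ENNReal.ofReal_natCast]
        gcongr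
        exact (densityMeasure_le hps ((continuous_cellCoord k).measurable hmeas)).trans
          (mul_le_mul_right hcell _)
    _ = ENNReal.ofReal (bu * n / (m : ℝ) ^ d) := by
        rw [← ENNReal.ofReal_mul' (by positivity), ← ENNReal.ofReal_mul (by positivity)]
        congr 1
        ring
    _ ≤ ENNReal.ofReal (1 / 2) := by
        apply ENNReal.ofReal_le_ofReal
        rw [div_le_iff₀ (by positivity)]
        linarith
    _ = 1 / 2 := by rw [ENNReal.ofReal_div_of_pos two_pos]; simp

variable [IsProbabilityMeasure (densityMeasure d pt)] [IsProbabilityMeasure (densityMeasure d ps)]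

theorem mul_sum_plateau_div_sqrt_card_le_minimaxRisk (hm : m ≠ 0)
    (hps : ∀ x ∈ cube d, ps x ≤ bu) (hmn : 2 * bu * n ≤ (m : ℝ) ^ d) (hψ : IsCubeBump ψ)
    (hM : 0 ≤ M) (hA : 0 ≤ A) {S : Finset (Fin d → Fin m)}
    (hC : ∀ T ⊆ S, (bumpSum M A ψ T, ps) ∈ C) :
    ENNReal.ofReal (((M + A) ^ q - M ^ q) *
        (∑ k ∈ S, (densityMeasure d pt).real (cellCoord k ⁻¹' (ψ ⁻¹' {1}))) / (8 * √S.card)) ≤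
      minimaxRisk d q n pt C := by
  have hplateau := fun k : Fin d → Fin m =>
    mul_densityMeasure_plateau_le_bumpMoment (pt := pt) hψ q hM hA k
  have hgain : 0 ≤ (M + A) ^ q - M ^ q :=
    sub_nonneg.2 (pow_le_pow_left₀ hM (le_add_of_nonneg_right hA) q)
  have hflip : ∀ y, ∀ T, ∀ U ⊆ S, (∀ k ∈ U, y ∉ cellCoord k ⁻¹' interior (cube d)) →
      bumpSum M A ψ (symmDiff T U) y = bumpSum M A ψ T y := by
    intro y T U _ hy
    have hzero : ∀ k ∈ U, ψ (cellCoord k y) = 0 := fun k hk =>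
      Function.notMem_support.1 fun h => hy k hk (hψ.support_subset h)
    simp only [bumpSum]
    congr 2
    refine Finset.sum_congr_of_eq_on_inter (fun k hk hkT => hzero k ?_) (fun k hkT hk => hzero k ?_)
      fun _ _ _ => rfl <;> grind [Finset.mem_symmDiff]
  refine le_trans (ENNReal.ofReal_le_ofReal ?_) (sum_div_sqrt_card_le_minimaxRisk
    (E := fun k => cellCoord k ⁻¹' interior (cube d))
    (fun k _ => (continuous_cellCoord k).measurable isOpen_interior.measurableSet)
    (fun k _ => mul_densityMeasure_cell_le_half hm hps hmn k)
    (fun T _ => (contDiff_bumpSum hψ.contDiff T).continuous.measurable) hC hflip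
    (fun k _ => (mul_nonneg hgain measureReal_nonneg).trans (hplateau k))
    (fun T _ => moment_bumpSum hψ q T))
  rw [Finset.mul_sum]
  gcongr with k _
  exact hplateau k

theorem mul_sqrt_div_le_minimaxRisk (hm : m ≠ 0) (hps : ∀ x ∈ cube d, ps x ≤ bu)
    (hmn : 2 * bu * n ≤ (m : ℝ) ^ d) (hψ : IsCubeBump ψ)
    (hhalf : 1 / 2 ≤
      ∑ k : Fin d → Fin m, (densityMeasure d pt).real (cellCoord k ⁻¹' (ψ ⁻¹' {1})))
    (hM : 0 ≤ M) (hA : 0 ≤ A) {j : ℕ} (hj : j ≤ m ^ d)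
    (hC : ∀ T : Finset (Fin d → Fin m), T.card ≤ j → (bumpSum M A ψ T, ps) ∈ C) :
    ENNReal.ofReal (((M + A) ^ q - M ^ q) * (√j / (16 * (m : ℝ) ^ d))) ≤
      minimaxRisk d q n pt C := by
  have hgain : 0 ≤ (M + A) ^ q - M ^ q :=
    sub_nonneg.2 (pow_le_pow_left₀ hM (le_add_of_nonneg_right hA) q)
  obtain ⟨S, -, hScard, hS⟩ := exists_subset_card_eq_and_mul_sum_le
    (fun k : Fin d → Fin m => (densityMeasure d pt).real (cellCoord k ⁻¹' (ψ ⁻¹' {1})))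
    Finset.univ (j := j) (by simpa using hj)
  refine le_trans (ENNReal.ofReal_le_ofReal ?_) (mul_sum_plateau_div_sqrt_card_le_minimaxRisk
    hm hps hmn hψ hM hA fun T hT => hC T ((Finset.card_le_card hT).trans_eq hScard))
  rw [mul_div_assoc, hScard]
  refine mul_le_mul_of_nonneg_left ?_ hgain
  have hmass : (j : ℝ) / (2 * (m : ℝ) ^ d) ≤
      ∑ k ∈ S, (densityMeasure d pt).real (cellCoord k ⁻¹' (ψ ⁻¹' {1})) := by
    simp only [Finset.card_univ, Fintype.card_fun, Fintype.card_fin, Nat.cast_pow] at hS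
    rw [div_le_iff₀ (by positivity)]
    linarith [mul_le_mul_of_nonneg_left hhalf (Nat.cast_nonneg (α := ℝ) j)]
  calc √j / (16 * (m : ℝ) ^ d) = j / (2 * (m : ℝ) ^ d) / (8 * √j) := by
        conv_lhs => rw [← Real.div_sqrt (x := (j : ℝ))]
        ring
    _ ≤ _ := by gcongr

end BumpLowerBound

section ShiftClass

variable {d s : ℕ} {p bl bu B L : ℝ} {f ps pt : (Fin d → ℝ) → ℝ}

theorem target_le_of_mem_shiftClass (hbl : 0 < bl) (hB : 0 ≤ B)
    (h : (f, ps, pt) ∈ shiftClass d s p bl bu B) : ∀ x ∈ cube d, pt x ≤ B * bu := by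
  obtain ⟨-, -, -, hps, hratio⟩ := h
  intro x hx
  exact ((div_le_iff₀ (hbl.trans_le (hps x hx).1)).1 (hratio x hx)).trans
    (mul_le_mul_of_nonneg_left (hps x hx).2 hB)

theorem mem_shiftClassBallAt_of_contDiff (h : (f, ps, pt) ∈ shiftClass d s p bl bu B)
    {g : (Fin d → ℝ) → ℝ} (hg : ContDiff ℝ ∞ g) (hgL : sobolevNorm d s p g ≤ ENNReal.ofReal L) :
    (g, ps) ∈ shiftClassBallAt d s p bl bu B L pt :=
  ⟨⟨memSobolev_of_contDiff hg, h.2⟩, hgL⟩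

end ShiftClass

section Rate

theorem exists_pow_mem_Icc {d : ℕ} (hd : 0 < d) {x : ℝ} (hx : 1 ≤ x) :
    ∃ m : ℕ, (m : ℝ) ^ d ∈ Set.Icc x (2 ^ d * x) := by
  set y : ℝ := x ^ (d : ℝ)⁻¹
  have hyd : y ^ d = x := Real.rpow_inv_natCast_pow (by linarith) hd.ne'
  have hy : 1 ≤ y := Real.one_le_rpow hx (by positivity)
  have hceil := Nat.ceil_lt_add_one (zero_le_one.trans hy)
  refine ⟨⌈y⌉₊, ?_, ?_⟩
  · rw [← hyd]
    gcongr
    exact Nat.le_ceil y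
  · rw [← hyd, ← mul_pow]
    gcongr
    linarith

theorem min_rpow_le_rpow {a b x : ℝ} (ha : 0 < a) (hax : a ≤ x) (hxb : x ≤ b) (e : ℝ) :
    min (a ^ e) (b ^ e) ≤ x ^ e := by
  rcases le_total 0 e with he | he
  · exact (min_le_left _ _).trans (Real.rpow_le_rpow ha.le hax he)
  · exact (min_le_right _ _).trans (Real.rpow_le_rpow_of_nonpos (ha.trans_le hax) hxb he)

theorem exists_grid_size {d : ℕ} (hd : 0 < d) {b : ℝ} (hb : 0 < b) (e : ℝ) :
    ∃ c : ℝ, 0 < c ∧ ∀ {n : ℕ}, 0 < n → 1 ≤ b * n →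
      ∃ m : ℕ, m ≠ 0 ∧ b * n ≤ (m : ℝ) ^ d ∧ c * (n : ℝ) ^ e ≤ ((m : ℝ) ^ d) ^ e := by
  refine ⟨min (b ^ e) ((2 ^ d * b) ^ e), by positivity, fun {n} hn hbn => ?_⟩
  have hn0 : (0 : ℝ) < n := Nat.cast_pos.2 hn
  obtain ⟨m, hlow, hupp⟩ := exists_pow_mem_Icc hd hbn
  have hratio := min_rpow_le_rpow hb ((le_div_iff₀ hn0).2 hlow)
    ((div_le_iff₀ hn0).2 (by rwa [mul_assoc])) e
  rw [Real.div_rpow (by positivity) hn0.le, le_div_iff₀ (by positivity)] at hratio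
  have hm : m ≠ 0 := by
    rintro rfl
    rw [Nat.cast_zero, zero_pow hd.ne'] at hlow
    linarith
  exact ⟨m, hm, hlow, hratio⟩

/-- The height, relative to the constant `M`, at which `j` bumps in the grid of mesh `1 / m` have
derivatives of order `s` of the size of `M` in `L^p`. -/
noncomputable def criticalHeight (d s : ℕ) (p : ℝ) (m j : ℕ) : ℝ :=
  ((m : ℝ) ^ s * (j / (m : ℝ) ^ d) ^ (1 / p))⁻¹

theorem criticalHeight_nonneg (d s : ℕ) (p : ℝ) (m j : ℕ) : 0 ≤ criticalHeight d s p m j := by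
  unfold criticalHeight
  positivity

theorem criticalHeight_eq_rpow {d : ℕ} (hd : 0 < d) (s : ℕ) (p : ℝ) (m j : ℕ) :
    criticalHeight d s p m j =
      ((m : ℝ) ^ d) ^ (-((s : ℝ) / d)) * (j / (m : ℝ) ^ d) ^ (-(1 / p)) := by
  have hms : (m : ℝ) ^ s = ((m : ℝ) ^ d) ^ ((s : ℝ) / d) := by
    rw [← Real.rpow_natCast _ d, ← Real.rpow_mul (Nat.cast_nonneg m),
      mul_div_cancel₀ _ (Nat.cast_pos.2 hd).ne', Real.rpow_natCast]
  rw [criticalHeight, hms, mul_inv, Real.rpow_neg (by positivity), Real.rpow_neg (by positivity)]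

theorem rpow_le_one_high_bump {d : ℕ} (hd : 0 < d) (s : ℕ) {q : ℕ} (hq : q ≠ 0) (p : ℝ) {m : ℕ}
    (hm : m ≠ 0) :
    ((m : ℝ) ^ d) ^ (-(q : ℝ) * ((s : ℝ) / d - 1 / p) - 1) ≤
      ((1 + criticalHeight d s p m 1) ^ q - 1) * (√(1 : ℕ) / (m : ℝ) ^ d) := by
  have hpow := pow_add_pow_le zero_le_one (criticalHeight_nonneg d s p m 1) hq
  rw [one_pow] at hpow
  set N : ℝ := (m : ℝ) ^ d
  have hN : 0 < N := by positivity
  calc N ^ (-(q : ℝ) * ((s : ℝ) / d - 1 / p) - 1)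
      = criticalHeight d s p m 1 ^ q * (√(1 : ℕ) / N) := by
        rw [criticalHeight_eq_rpow hd, Nat.cast_one, Real.sqrt_one, one_div N, ← Real.rpow_neg_one,
          ← Real.rpow_mul hN.le, ← Real.rpow_add hN, ← Real.rpow_natCast, ← Real.rpow_mul hN.le,
          ← Real.rpow_add hN]
        congr 1
        ring
    _ ≤ _ := by
        gcongr
        linarith

theorem rpow_le_all_low_bumps {d : ℕ} (hd : 0 < d) (s : ℕ) {q : ℕ} (hq : q ≠ 0) (p : ℝ) {m : ℕ}
    (hm : m ≠ 0) :
    ((m : ℝ) ^ d) ^ (-(1 / 2) - (s : ℝ) / d) ≤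
      ((1 + criticalHeight d s p m (m ^ d)) ^ q - 1) * (√(m ^ d : ℕ) / (m : ℝ) ^ d) := by
  have hpow := le_self_pow₀ (le_add_of_nonneg_right (criticalHeight_nonneg d s p m (m ^ d))) hq
  rw [Nat.cast_pow]
  set N : ℝ := (m : ℝ) ^ d with hNdef
  have hN : 0 < N := by positivity
  calc N ^ (-(1 / 2) - (s : ℝ) / d) = criticalHeight d s p m (m ^ d) * (√N / N) := by
        rw [criticalHeight_eq_rpow hd, Nat.cast_pow, ← hNdef, div_self hN.ne', Real.one_rpow,
          mul_one, Real.sqrt_div_self', one_div √N, Real.sqrt_eq_rpow, ← Real.rpow_neg hN.le,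
          ← Real.rpow_add hN]
        congr 1
        ring
    _ ≤ _ := by
        gcongr
        linarith

theorem exists_rpow_rateExponent_le {d : ℕ} (hd : 0 < d) (s : ℕ) {q : ℕ} (hq : q ≠ 0) (p : ℝ)
    {m : ℕ} (hm : m ≠ 0) :
    ∃ j : ℕ, 0 < j ∧ j ≤ m ^ d ∧ ((m : ℝ) ^ d) ^ rateExponent d s q p ≤
      ((1 + criticalHeight d s p m j) ^ q - 1) * (√j / (m : ℝ) ^ d) := by
  have hcells : 0 < m ^ d := by positivity
  rcases max_choice (-(q : ℝ) * ((s : ℝ) / d - 1 / p) - 1) (-(1 / 2) - (s : ℝ) / d)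
    with hmax | hmax <;> rw [rateExponent, hmax]
  · exact ⟨1, one_pos, hcells, rpow_le_one_high_bump hd s hq p hm⟩
  · exact ⟨m ^ d, hcells, le_rfl, rpow_le_all_low_bumps hd s hq p hm⟩

end Rate

section Ball

variable {d s q : ℕ} {p bu B : ℝ}

theorem exists_sobolevNorm_bumpSum_criticalHeight_le {ψ : (Fin d → ℝ) → ℝ} (hψ : IsCubeBump ψ)
    (s : ℕ) (hp : 1 ≤ p) :
    ∃ C : ℝ, 0 < C ∧ ∀ {m j : ℕ}, m ≠ 0 → 0 < j → ∀ {M : ℝ}, 0 ≤ M →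
      ∀ T : Finset (Fin d → Fin m), T.card ≤ j →
        sobolevNorm d s p (bumpSum M (M * criticalHeight d s p m j) ψ T) ≤
          ENNReal.ofReal (C * M) := by
  obtain ⟨C, hC, hbound⟩ := exists_sobolevNorm_bumpSum_le hψ s hp
  refine ⟨C * 2, by positivity, fun {m j} hm hj {M} hM T hT => ?_⟩
  have hheight := criticalHeight_nonneg d s p m j
  refine (hbound hm hM (mul_nonneg hM hheight) T).trans (ENNReal.ofReal_le_ofReal ?_)
  have hnorm : criticalHeight d s p m j * ((m : ℝ) ^ s * (j / (m : ℝ) ^ d) ^ (1 / p)) = 1 :=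
    inv_mul_cancel₀ (by positivity)
  calc C * (M + M * criticalHeight d s p m j * m ^ s * (T.card / (m : ℝ) ^ d) ^ (1 / p))
      ≤ C * (M + M * criticalHeight d s p m j * m ^ s * (j / (m : ℝ) ^ d) ^ (1 / p)) := by
        gcongr
    _ = C * 2 * M := by linear_combination C * M * hnorm

theorem exists_mul_rpow_le_minimaxRisk_ball (hd : 0 < d) (s : ℕ) (hp : 1 ≤ p) (hq : q ≠ 0)
    (hbu : 0 < bu) (hB : 0 < B) :
    ∃ c : ℝ, 0 < c ∧ ∀ {bl L : ℝ}, 0 < bl → 0 < L → ∀ {f ps pt : (Fin d → ℝ) → ℝ},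
      (f, ps, pt) ∈ shiftClass d s p bl bu B → ∀ {n : ℕ}, 0 < n →
        ENNReal.ofReal (c * L ^ q * (n : ℝ) ^ rateExponent d s q p) ≤
          minimaxRisk d q n pt (shiftClassBallAt d s p bl bu B L pt) := by
  obtain ⟨ψ, hψ, hplateau⟩ := exists_isCubeBump_half_le_sum d (mul_pos hB hbu)
  obtain ⟨C, hC, hSobolev⟩ := exists_sobolevNorm_bumpSum_criticalHeight_le hψ s hp
  obtain ⟨c, hc, hgrid⟩ :=
    exists_grid_size hd (b := 2 * bu) (by positivity) (rateExponent d s q p)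
  refine ⟨c / (16 * C ^ q), by positivity, fun {bl L} hbl hL {f ps pt} h n hn => ?_⟩
  have hps : IsDensity d ps := h.2.1
  have hpt : IsDensity d pt := h.2.2.1
  have hpsbu : ∀ x ∈ cube d, ps x ≤ bu := fun x hx => (h.2.2.2.1 x hx).2
  have := hps.isProbabilityMeasure
  have := hpt.isProbabilityMeasure
  have hbu1 : 1 ≤ bu := hps.one_le_of_le hpsbu
  have hn1 : (1 : ℝ) ≤ n := Nat.one_le_cast.2 hn
  obtain ⟨m, hm, hmn, hrate⟩ := hgrid hn (by nlinarith)
  obtain ⟨j, hj, hjm, hgain⟩ := exists_rpow_rateExponent_le hd s hq p hm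
  have hheight := criticalHeight_nonneg d s p m j
  refine le_trans (ENNReal.ofReal_le_ofReal ?_) (mul_sqrt_div_le_minimaxRisk (M := L / C)
    (A := L / C * criticalHeight d s p m j) hm hpsbu hmn hψ
    (hplateau hm hpt (target_le_of_mem_shiftClass hbl hB.le h)) (by positivity) (by positivity) hjm
    fun T hT => mem_shiftClassBallAt_of_contDiff h (contDiff_bumpSum hψ.contDiff T) ?_)
  · calc c / (16 * C ^ q) * L ^ q * (n : ℝ) ^ rateExponent d s q p
        = (L / C) ^ q / 16 * (c * (n : ℝ) ^ rateExponent d s q p) := by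
          rw [div_pow]
          field_simp
      _ ≤ (L / C) ^ q / 16 * (((1 + criticalHeight d s p m j) ^ q - 1) * (√j / (m : ℝ) ^ d)) :=
          mul_le_mul_of_nonneg_left (hrate.trans hgain) (by positivity)
      _ = ((L / C + L / C * criticalHeight d s p m j) ^ q - (L / C) ^ q) *
            (√j / (16 * (m : ℝ) ^ d)) := by
          rw [← mul_one_add (L / C), mul_pow]
          ring
  · exact (hSobolev hm hj (by positivity) T hT).trans_eq (by rw [mul_div_cancel₀ _ hC.ne'])

theorem minimaxRisk_mono {d q n : ℕ} {pt : (Fin d → ℝ) → ℝ}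
    {C C' : Set (((Fin d → ℝ) → ℝ) × ((Fin d → ℝ) → ℝ))} (h : C ⊆ C') :
    minimaxRisk d q n pt C ≤ minimaxRisk d q n pt C' :=
  iInf₂_mono fun _ _ => biSup_mono h

theorem minimaxRisk_shiftClassAt_eq_top (hd : 0 < d) (hp : 1 ≤ p) (hq : q ≠ 0) {bl : ℝ}
    (hbl : 0 < bl) (hB : 0 < B) {f ps pt : (Fin d → ℝ) → ℝ}
    (h : (f, ps, pt) ∈ shiftClass d s p bl bu B) {n : ℕ} (hn : 0 < n) :
    minimaxRisk d q n pt (shiftClassAt d s p bl bu B pt) = ⊤ := by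
  have hbu : 0 < bu := zero_lt_one.trans_le (h.2.1.one_le_of_le fun x hx => (h.2.2.2.1 x hx).2)
  obtain ⟨c, hc, hball⟩ := exists_mul_rpow_le_minimaxRisk_ball hd s hp hq hbu hB
  set r : ℝ := c * (n : ℝ) ^ rateExponent d s q p
  have hr : 0 < r := by positivity
  refine ENNReal.eq_top_of_forall_nnreal_le fun t => ?_
  have hL : (1 : ℝ) ≤ 1 + t / r := le_add_of_nonneg_right (by positivity)
  calc (t : ℝ≥0∞) = ENNReal.ofReal t := (ENNReal.ofReal_coe_nnreal).symm
    _ ≤ ENNReal.ofReal (c * (1 + t / r) ^ q * (n : ℝ) ^ rateExponent d s q p) := by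
        apply ENNReal.ofReal_le_ofReal
        calc (t : ℝ) = t / r * r := (div_mul_cancel₀ _ hr.ne').symm
          _ ≤ (1 + t / r) ^ q * r := by
              gcongr
              linarith [le_self_pow₀ hL hq]
          _ = _ := by ring
    _ ≤ minimaxRisk d q n pt (shiftClassBallAt d s p bl bu B (1 + t / r) pt) :=
        hball hbl (by positivity) h hn
    _ ≤ minimaxRisk d q n pt (shiftClassAt d s p bl bu B pt) := minimaxRisk_mono fun _ hv => hv.1

end Ball

end CovShift

theorem theorem1_general (d s q : ℕ) (p : ℝ) (hd : 0 < d) (hp : 1 ≤ p) (hq : q ≠ 0) :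
    (∀ bl bu B : ℝ, 0 < bl → 0 < B →
      ∀ pt : (Fin d → ℝ) → ℝ, (∃ f ps, (f, ps, pt) ∈ CovShift.shiftClass d s p bl bu B) →
        ∀ n : ℕ, 0 < n →
          CovShift.minimaxRisk d q n pt (CovShift.shiftClassAt d s p bl bu B pt) = ⊤) ∧
    (∀ bu B L : ℝ, 0 < bu → 0 < B → 0 < L →
      ∃ c : ℝ, 0 < c ∧ ∀ bl : ℝ, 0 < bl →
        ∀ pt : (Fin d → ℝ) → ℝ, (∃ f ps, (f, ps, pt) ∈ CovShift.shiftClass d s p bl bu B) →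
          ∀ n : ℕ, 0 < n →
            ENNReal.ofReal (c * (B * bu * (n : ℝ) ^ CovShift.rateExponent d s q p))
              ≤ CovShift.minimaxRisk d q n pt
                  (CovShift.shiftClassBallAt d s p bl bu B L pt)) := by
  refine ⟨fun bl bu B hbl hB pt ⟨f, ps, h⟩ n hn =>
    CovShift.minimaxRisk_shiftClassAt_eq_top hd hp hq hbl hB h hn, fun bu B L hbu hB hL => ?_⟩
  obtain ⟨c, hc, hball⟩ := CovShift.exists_mul_rpow_le_minimaxRisk_ball hd s hp hq hbu hB
  refine ⟨c * L ^ q / (B * bu), by positivity, fun bl hbl pt ⟨f, ps, h⟩ n hn => ?_⟩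
  rw [← mul_assoc, div_mul_cancel₀ _ (mul_pos hB hbu).ne']
  exact hball hbl hL h hn

theorem theorem1 (d s q : ℕ) (p : ℝ) (hd : 0 < d) (hp : 2 ≤ p) (hqp : (q : ℝ) ≤ p)
    (hpq : p ≤ 2 * q) :
    (∃ c : ℝ, 0 < c ∧ ∀ bl bu B : ℝ, 0 < bl → bl ≤ bu → 1 ≤ B →
      ∀ pt : (Fin d → ℝ) → ℝ, (∃ f ps, (f, ps, pt) ∈ CovShift.shiftClass d s p bl bu B) →
        ∀ n : ℕ, 0 < n →
          ENNReal.ofReal (c * (B * bu * (n : ℝ) ^ CovShift.rateExponent d s q p))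
            ≤ CovShift.minimaxRisk d q n pt (CovShift.shiftClassAt d s p bl bu B pt)) ∧
    (∀ bl bu B L : ℝ, 0 < bl → bl ≤ bu → 1 ≤ B → 0 < L →
      ∃ c : ℝ, 0 < c ∧
        ∀ pt : (Fin d → ℝ) → ℝ, (∃ f ps, (f, ps, pt) ∈ CovShift.shiftClass d s p bl bu B) →
          ∀ n : ℕ, 0 < n →
            ENNReal.ofReal (c * (B * bu * (n : ℝ) ^ CovShift.rateExponent d s q p))
              ≤ CovShift.minimaxRisk d q n pt
                  (CovShift.shiftClassBallAt d s p bl bu B L pt)) := by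
  have hq : q ≠ 0 := by
    rintro rfl
    rw [Nat.cast_zero, mul_zero] at hpq
    linarith
  obtain ⟨hspace, hball⟩ := theorem1_general d s q p hd (by linarith) hq
  refine ⟨⟨1, one_pos, fun bl bu B hbl _ hB pt hpt n hn => ?_⟩, fun bl bu B L hbl hbu hB hL => ?_⟩
  · exact le_top.trans_eq (hspace bl bu B hbl (by linarith) pt hpt n hn).symm
  · obtain ⟨c, hc, hrisk⟩ := hball bu B L (by linarith) (by linarith) hL
    exact ⟨c, hc, hrisk bl hbl⟩
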